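/- For a finite field $\mathbb F_q$ and $x\in\mathbb F_q^2$ write $\|x\|=x_1^2+x_2^2$; for $t\in\mathbb F_q^*$ let $S_t=\{x\in\mathbb F_q^2:\|x\|=t\}$, and write $S_t(\cdot)$ also for its indicator function. For $f:\mathbb F_q^2\to\mathbb R$ put $\|f\|_p=\big(q^{-2}\sum_{x}|f(x)|^p\big)^{1/p}$ if $1\le p<\infty$, and $\|f\|_\infty=\max_x|f(x)|$. For non-negative $f_1,\dots,f_4:\mathbb F_q^2\to\mathbb R$ define the ($C_4$ + diagonal)-form $$\diamondsuit_t(f_1,f_2,f_3,f_4)=\frac1{q^2|S_t|}\sum_{x^1,x^2,x^3,x^4\in\mathbb F_q^2}S_t(x^1-x^2)S_t(x^2-x^3)S_t(x^3-x^4)S_t(x^4-x^1)S_t(x^1-x^3)\prod_{i=1}^4f_i(x^i).$$ For $1\le p_1,\dots,p_4\le\infty$, write $\diamondsuit_t(p_1,p_2,p_3,p_4)\lesssim1$ if there is a constant $C>0$ such that $$\diamondsuit_t(f_1,f_2,f_3,f_4)\le C\,\|f_1\|_{p_1}\|f_2\|_{p_2}\|f_3\|_{p_3}\|f_4\|_{p_4}$$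 for all finite fields $\mathbb F_q$ in which $3$ is a square, all $t\in\mathbb F_q^*$ and all non-negative $f_1,\dots,f_4$ on $\mathbb F_q^2$. Write $\diamondsuit_t(p_1,p_2,p_3,p_4)\lessapprox1$ (restricted strong type) if the same holds whenever $f_1,\dots,f_4$ are indicator functions of subsets of $\mathbb F_q^2$. **Theorem.** Let $1\le p_1,p_2,p_3,p_4\le\infty$, with the convention $1/\infty=0$, and consider the conditions $$\frac1{p_1}+\frac1{p_2}+\frac2{p_3}+\frac1{p_4}\le2,\qquad \frac2{p_1}+\frac1{p_2}+\frac1{p_3}+\frac1{p_4}\le2,\qquad \frac1{p_1}+\frac2{p_2}+\frac1{p_3}+\frac2{p_4}\le2.\tag{$*$}$$ (i) If $\diamondsuit_t(p_1,p_2,p_3,p_4)\lesssim1$, then $(*)$ holds. (ii) Conversely, if $(*)$ holds and $(p_1,p_2,p_3,p_4)$ is neither $(2,2,2,\infty)$ nor $(2,\infty,2,2)$, then $\diamondsuit_t(p_1,p_2,p_3,p_4)\lesssim1$. (iii) At the two remaining points, $\diamondsuit_t(2,\infty,2,2)\lessapprox1$ and $\diamondsuit_t(2,2,2,\infty)\lessapprox1$.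 -/

import Mathlib

open scoped ENNReal

noncomputable section

namespace DiamondForm

/-- The quadratic form `‖x‖ = x₁² + x₂²` on the plane `F²`. -/
def quadNorm {F : Type} [Field F] (x : Fin 2 → F) : F := ∑ i, x i ^ 2

/-- The circle `S_t = {x ∈ F² : ‖x‖ = t}`. -/
def circle {F : Type} [Field F] (t : F) : Set (Fin 2 → F) := {x | quadNorm x = t}

/-- The indicator function of `S_t`. -/
def circleInd {F : Type} [Field F] (t : F) : (Fin 2 → F) → ℝ := (circle t).indicator 1

/-- The `L^p` norm on `F²` with respect to normalized counting measure, `1 ≤ p ≤ ∞`: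
`(q⁻² ∑ₓ |f x|^p)^(1/p)` for finite `p`, and `max |f|` for `p = ∞`. -/
def lpNorm {F : Type} [Field F] [Fintype F] (p : ℝ≥0∞) (f : (Fin 2 → F) → ℝ) : ℝ :=
  if p = ∞ then ⨆ x, |f x|
  else (((Fintype.card F : ℝ) ^ 2)⁻¹ * ∑ x, |f x| ^ p.toReal) ^ (1 / p.toReal)

/-- The form `♦_t(f₁, f₂, f₃, f₄)` on `F²`, attached to the 4-cycle `x¹x²x³x⁴` together with the
diagonal `x¹x³`. The normalizing factor is `q² |S_t|`: in the plane the factor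
`|S_t^{d-2}| ∼ q^{d-2}` that occurs in dimension `d` is taken to be `1`. -/
def diamond {F : Type} [Field F] [Fintype F] (t : F) (f₁ f₂ f₃ f₄ : (Fin 2 → F) → ℝ) : ℝ :=
  ((Fintype.card F : ℝ) ^ 2 * ((circle t).ncard : ℝ))⁻¹ *
    ∑ x₁, ∑ x₂, ∑ x₃, ∑ x₄,
      circleInd t (x₁ - x₂) * circleInd t (x₂ - x₃) * circleInd t (x₃ - x₄) *
        circleInd t (x₄ - x₁) * circleInd t (x₁ - x₃) *
        (f₁ x₁ * f₂ x₂ * f₃ x₃ * f₄ x₄)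

/-- `♦_t(p₁, p₂, p₃, p₄) ≲ 1`: the estimate
`♦_t(f₁, f₂, f₃, f₄) ≤ C ‖f₁‖_{p₁} ‖f₂‖_{p₂} ‖f₃‖_{p₃} ‖f₄‖_{p₄}` holds for all non-negative `fᵢ`
with one constant `C` for all finite fields in which `3` is a square and all `t ≠ 0`. -/
def Bounded (p₁ p₂ p₃ p₄ : ℝ≥0∞) : Prop :=
  ∃ C : ℝ, 0 < C ∧
    ∀ (F : Type) [Field F] [Fintype F], IsSquare (3 : F) → ∀ t : F, t ≠ 0 →
      ∀ f₁ f₂ f₃ f₄ : (Fin 2 → F) → ℝ,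
        (∀ x, 0 ≤ f₁ x) → (∀ x, 0 ≤ f₂ x) → (∀ x, 0 ≤ f₃ x) → (∀ x, 0 ≤ f₄ x) →
        diamond t f₁ f₂ f₃ f₄ ≤
          C * (lpNorm p₁ f₁ * lpNorm p₂ f₂ * lpNorm p₃ f₃ * lpNorm p₄ f₄)

/-- The restricted strong-type estimate `♦_t(p₁, p₂, p₃, p₄) ⪅ 1`: the same estimate for
indicator functions of arbitrary subsets of `F²`. -/
def RestrictedBounded (p₁ p₂ p₃ p₄ : ℝ≥0∞) : Prop :=
  ∃ C : ℝ, 0 < C ∧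
    ∀ (F : Type) [Field F] [Fintype F], IsSquare (3 : F) → ∀ t : F, t ≠ 0 →
      ∀ E₁ E₂ E₃ E₄ : Set (Fin 2 → F),
        diamond t (E₁.indicator 1) (E₂.indicator 1) (E₃.indicator 1) (E₄.indicator 1) ≤
          C * (lpNorm p₁ (E₁.indicator 1) * lpNorm p₂ (E₂.indicator 1) *
            lpNorm p₃ (E₃.indicator 1) * lpNorm p₄ (E₄.indicator 1))

/-- The three necessary conditions on the exponents, in dimension `d = 2`
(with `1/∞ = 0`). -/
def NecessaryConditions (p₁ p₂ p₃ p₄ : ℝ≥0∞) : Prop :=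
  1 / p₁ + 1 / p₂ + 2 / p₃ + 1 / p₄ ≤ 2 ∧
  2 / p₁ + 1 / p₂ + 1 / p₃ + 1 / p₄ ≤ 2 ∧
  1 / p₁ + 2 / p₂ + 1 / p₃ + 2 / p₄ ≤ 2

end DiamondForm

end

noncomputable section

namespace DiamondForm

/-! Join x and y when ‖x − y‖ = t. This graph on q² points has degree at most 2q. Since two distinct
circles of equal nonzero radius meet in at most two points, two vertices have at most two common
neighbours. The upper bound uses only this (`IsCodegreeKernel`) and |S_t| ≥ q/3 for nonempty
circles; characteristic 2 is trivial.

Put aᵢ = 1/pᵢ and dominate fᵢ by ‖fᵢ‖ gᵢ^{aᵢ} with gᵢ of mean one. The vertices x² and x⁴ play the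
same role, so g₂^{a₂} g₄^{a₄} may be replaced by g₂^{a₂+a₄} + g₄^{a₂+a₄}. In each term one vertex is
then free and has at most two positions. What remains is a triangle form with exponents (a₁, a₂+a₄,
a₃), and (*) places this triple in the polytope whose vertices are 0, (1/2, 1/2, 1/2) and the
permutations of (1, 0, 0) and (2/3, 2/3, 0). A pointwise bound by the vertex monomials replaces
interpolation (`rpow_monomial_le_vertexSum`). The vertices themselves are handled by the degree
bound, an L^{3/2} → L³ edge estimate (`sum_edge_le`) and a triangle estimate for three L² functions
(`sum_triangle_le`). Both exceptional quadruples go to (1/2, 1/2, 1/2), where the triangle estimate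
is of strong type, so (iii) follows from the same bound.

For necessity, in characteristic 3 the differences of 0, 1, −1 have square 1, so 0, x, −x is an
equilateral triangle for every x ∈ S₁. Testing on {0} and S₁ over fields with 3ⁿ elements gives (*).
-/

/-! ### Edge and triangle estimates for kernels of bounded codegree -/

/-- A symmetric kernel with values in `[0, 1]`, vanishing on the diagonal, of degree at most `D`
and of codegree at most `2`. -/
structure IsCodegreeKernel {V : Type*} [Fintype V] (w : V → V → ℝ) (D : ℝ) : Prop where
  nonneg : ∀ x y, 0 ≤ w x y
  le_one : ∀ x y, w x y ≤ 1
  symm : ∀ x y, w x y = w y x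
  irrefl : ∀ x, w x x = 0
  degree : ∀ x, ∑ y, w x y ≤ D
  codegree : ∀ x y, x ≠ y → ∑ z, w x z * w y z ≤ 2

/-- A Hölder inequality for weighted sums. -/
theorem cube_sum_sq_le {V : Type*} (s : Finset V) (w c : V → ℝ) (hw : ∀ y, 0 ≤ w y)
    (hc : ∀ y, 0 ≤ c y) :
    (∑ y ∈ s, w y * c y ^ 2) ^ 3 ≤ (∑ y ∈ s, w y) * (∑ y ∈ s, w y * c y ^ 3) ^ 2 := by
  have h1 : (∑ y ∈ s, w y * c y ^ 2) ^ 2 ≤ (∑ y ∈ s, w y * c y ^ 3) * ∑ y ∈ s, w y * c y :=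
    Finset.sum_sq_le_sum_mul_sum_of_sq_le_mul s
      (fun y _ => mul_nonneg (hw y) (pow_nonneg (hc y) 3)) (fun y _ => mul_nonneg (hw y) (hc y))
      (fun y _ => le_of_eq (by ring))
  have h2 : (∑ y ∈ s, w y * c y) ^ 2 ≤ (∑ y ∈ s, w y) * ∑ y ∈ s, w y * c y ^ 2 :=
    Finset.sum_sq_le_sum_mul_sum_of_sq_le_mul s
      (fun y _ => hw y) (fun y _ => mul_nonneg (hw y) (pow_nonneg (hc y) 2))
      (fun y _ => le_of_eq (by ring))
  have hR : 0 ≤ ∑ y ∈ s, w y * c y ^ 3 :=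
    Finset.sum_nonneg fun y _ => mul_nonneg (hw y) (pow_nonneg (hc y) 3)
  have hK : 0 ≤ ∑ y ∈ s, w y * c y := Finset.sum_nonneg fun y _ => mul_nonneg (hw y) (hc y)
  have hh : 0 ≤ ∑ y ∈ s, w y * c y ^ 2 :=
    Finset.sum_nonneg fun y _ => mul_nonneg (hw y) (pow_nonneg (hc y) 2)
  have hN : 0 ≤ ∑ y ∈ s, w y := Finset.sum_nonneg fun y _ => hw y
  generalize ∑ y ∈ s, w y * c y ^ 3 = R at *
  generalize ∑ y ∈ s, w y * c y = K at *
  generalize ∑ y ∈ s, w y * c y ^ 2 = h at *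
  generalize ∑ y ∈ s, w y = N at *
  rcases hh.eq_or_lt with rfl | hpos
  · simpa using mul_nonneg hN (sq_nonneg R)
  · refine le_of_mul_le_mul_right ?_ hpos
    calc h ^ 3 * h = (h ^ 2) ^ 2 := by ring
      _ ≤ (R * K) ^ 2 := pow_le_pow_left₀ (sq_nonneg h) h1 2
      _ = R ^ 2 * K ^ 2 := by ring
      _ ≤ R ^ 2 * (N * h) := mul_le_mul_of_nonneg_left h2 (sq_nonneg R)
      _ = N * R ^ 2 * h := by ring

/-- Discarding a largest term, the square of a sum is controlled by its off-diagonal part. -/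
theorem sq_sum_erase_le {V : Type*} [Fintype V] [DecidableEq V] (k : V → ℝ) (hk : ∀ y, 0 ≤ k y)
    (y₀ : V) (hmax : ∀ y, k y ≤ k y₀) :
    (∑ y ∈ Finset.univ.erase y₀, k y) ^ 2 ≤ ∑ y, ∑ z, if y = z then 0 else k y * k z := by
  set R := ∑ y ∈ Finset.univ.erase y₀, k y with hR
  have hR0 : 0 ≤ R := Finset.sum_nonneg fun y _ => hk y
  have hsum : ∑ y, k y = k y₀ + R := (Finset.add_sum_erase _ _ (Finset.mem_univ y₀)).symm
  have inner : ∀ y, (∑ z, if y = z then 0 else k y * k z) = k y * (k y₀ + R - k y) := by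
    intro y
    have : ∀ z, (if y = z then 0 else k y * k z) = k y * k z - if y = z then k y * k y else 0 := by
      intro z; split_ifs with h <;> simp [h]
    simp only [this, Finset.sum_sub_distrib, ← Finset.mul_sum, hsum]
    simp; ring
  simp only [inner]
  rw [← Finset.add_sum_erase _ _ (Finset.mem_univ y₀)]
  have h2 : ∑ y ∈ Finset.univ.erase y₀, k y * R ≤
      ∑ y ∈ Finset.univ.erase y₀, k y * (k y₀ + R - k y) :=
    Finset.sum_le_sum fun y _ => mul_le_mul_of_nonneg_left (by linarith [hmax y]) (hk y)
  rw [← Finset.sum_mul, ← hR] at h2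
  nlinarith [mul_nonneg (hk y₀) hR0]

/-- Split off the index with the largest `w y * c y ^ 3`. Its term is paid for by the diagonal sum,
the others by `cube_sum_sq_le` and `sq_sum_erase_le`. Only off-diagonal products carry the factor
`D`; these are the ones a codegree bound controls. -/
theorem cube_weighted_sum_le {V : Type*} [Fintype V] [DecidableEq V] (w c : V → ℝ)
    (hw : ∀ y, 0 ≤ w y) (hw1 : ∀ y, w y ≤ 1) (hc : ∀ y, 0 ≤ c y) {D : ℝ} (hD : ∑ y, w y ≤ D) :
    (∑ y, w y * c y ^ 2) ^ 3 ≤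
      4 * (∑ y, w y * (c y ^ 3) ^ 2 +
        D * ∑ y, ∑ z, if y = z then 0 else (w y * c y ^ 3) * (w z * c z ^ 3)) := by
  rcases isEmpty_or_nonempty V with hV | hV
  · simp
  obtain ⟨y₀, -, hmax⟩ := Finset.exists_max_image Finset.univ (fun y => w y * c y ^ 3)
    Finset.univ_nonempty
  have hk : ∀ y, 0 ≤ w y * c y ^ 3 := fun y => mul_nonneg (hw y) (pow_nonneg (hc y) 3)
  have h1 := sq_sum_erase_le (fun y => w y * c y ^ 3) hk y₀ (fun y => hmax y (Finset.mem_univ y))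
  have h2 := cube_sum_sq_le (Finset.univ.erase y₀) w c hw hc
  have hN : ∑ y ∈ Finset.univ.erase y₀, w y ≤ D :=
    (Finset.sum_le_sum_of_subset_of_nonneg (Finset.subset_univ _) fun y _ _ => hw y).trans hD
  have hN0 : 0 ≤ ∑ y ∈ Finset.univ.erase y₀, w y := Finset.sum_nonneg fun y _ => hw y
  have h3 : (w y₀ * c y₀ ^ 2) ^ 3 ≤ ∑ y, w y * (c y ^ 3) ^ 2 := by
    calc (w y₀ * c y₀ ^ 2) ^ 3 = w y₀ ^ 3 * (c y₀ ^ 3) ^ 2 := by ring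
      _ ≤ w y₀ * (c y₀ ^ 3) ^ 2 :=
        mul_le_mul_of_nonneg_right (pow_le_of_le_one (hw _) (hw1 _) (by norm_num)) (sq_nonneg _)
      _ ≤ _ := Finset.single_le_sum (f := fun y => w y * (c y ^ 3) ^ 2)
        (fun y _ => mul_nonneg (hw y) (sq_nonneg _)) (Finset.mem_univ y₀)
  rw [← Finset.add_sum_erase _ _ (Finset.mem_univ y₀)]
  have hA : 0 ≤ w y₀ * c y₀ ^ 2 := mul_nonneg (hw _) (sq_nonneg _)
  have hB : 0 ≤ ∑ y ∈ Finset.univ.erase y₀, w y * c y ^ 2 :=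
    Finset.sum_nonneg fun y _ => mul_nonneg (hw y) (sq_nonneg _)
  have h4 := h2.trans (mul_le_mul hN h1 (sq_nonneg _) (hN0.trans hN))
  generalize w y₀ * c y₀ ^ 2 = A at *
  generalize ∑ y ∈ Finset.univ.erase y₀, w y * c y ^ 2 = B at *
  -- 4(A³ + B³) − (A + B)³ = 3(A + B)(A − B)².
  nlinarith [mul_nonneg (add_nonneg hA hB) (sq_nonneg (A - B))]

namespace IsCodegreeKernel

variable {V : Type*} [Fintype V] {w : V → V → ℝ} {D : ℝ}

theorem sum_degree_mul_le (hw : IsCodegreeKernel w D) {f : V → ℝ} (hf : ∀ x, 0 ≤ f x) :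
    ∑ x, ∑ y, w x y * f y ≤ D * ∑ y, f y := by
  rw [Finset.sum_comm, Finset.mul_sum]
  refine Finset.sum_le_sum fun y _ => ?_
  rw [← Finset.sum_mul]
  refine mul_le_mul_of_nonneg_right ?_ (hf y)
  simpa only [hw.symm _ y] using hw.degree y

theorem mul_codegree_le (hw : IsCodegreeKernel w D) (x y : V) :
    w x y * ∑ z, w x z * w y z ≤ 2 * w x y := by
  by_cases h : x = y
  · simp [h, hw.irrefl]
  · nlinarith [hw.codegree x y h, hw.nonneg x y]

/-- The `L^{3/2} → L^3` estimate for the kernel, in bilinear form. -/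
theorem sum_edge_le (hw : IsCodegreeKernel w D) {a c : V → ℝ}
    (ha : ∀ x, 0 ≤ a x) (hc : ∀ x, 0 ≤ c x) {q : ℝ} (hq : 1 ≤ q) (hDq : D ≤ 2 * q)
    (hasum : ∑ x, a x ^ 3 = q ^ 2) (hcsum : ∑ x, c x ^ 3 = q ^ 2) :
    ∑ x, ∑ y, w x y * (a x ^ 2 * c y ^ 2) ≤ 100 * q ^ 3 := by
  classical
  have hq0 : 0 < q := by linarith
  have hc3 : ∀ x, 0 ≤ c x ^ 3 := fun x => pow_nonneg (hc x) 3
  -- The diagonal costs the degree, 2q · q⁴; the off-diagonal part costs the codegree, 2q · 2q⁴.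
  -- Hence 4(2 + 4) = 24.
  have key : ∑ x, (∑ y, w x y * c y ^ 2) ^ 3 ≤ 24 * q ^ 5 := by
    have h1 : ∑ x, (∑ y, w x y * c y ^ 2) ^ 3 ≤
        ∑ x, 4 * (∑ y, w x y * (c y ^ 3) ^ 2 + (2 * q) *
          ∑ y, ∑ z, if y = z then 0 else (w x y * c y ^ 3) * (w x z * c z ^ 3)) :=
      Finset.sum_le_sum fun x _ => cube_weighted_sum_le (w x) c (hw.nonneg x) (hw.le_one x) hc
        ((hw.degree x).trans hDq)
    rw [← Finset.mul_sum, Finset.sum_add_distrib, ← Finset.mul_sum] at h1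
    have h2 : ∑ x, ∑ y, w x y * (c y ^ 3) ^ 2 ≤ 2 * q * (q ^ 2) ^ 2 := by
      refine (hw.sum_degree_mul_le fun y => sq_nonneg _).trans ?_
      refine mul_le_mul hDq ?_ (Finset.sum_nonneg fun y _ => sq_nonneg _) (by positivity)
      rw [← hcsum]
      exact Finset.sum_sq_le_sq_sum_of_nonneg fun i _ => hc3 i
    have h3 : (∑ x, ∑ y, ∑ z, if y = z then 0 else (w x y * c y ^ 3) * (w x z * c z ^ 3)) ≤
        2 * (q ^ 2) ^ 2 := by
      rw [Finset.sum_comm, ← hcsum, sq (∑ x, c x ^ 3), Finset.sum_mul_sum, Finset.mul_sum]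
      refine Finset.sum_le_sum fun y _ => ?_
      rw [Finset.sum_comm, Finset.mul_sum]
      refine Finset.sum_le_sum fun z _ => ?_
      by_cases h : y = z
      · simp only [h, if_true, Finset.sum_const_zero]
        exact mul_nonneg (by norm_num) (mul_nonneg (hc3 z) (hc3 z))
      · simp only [h, if_false]
        have : ∀ x, (w x y * c y ^ 3) * (w x z * c z ^ 3) =
            (w y x * w z x) * (c y ^ 3 * c z ^ 3) := fun x => by
          rw [hw.symm x y, hw.symm x z]; ring
        simp only [this, ← Finset.sum_mul]
        exact mul_le_mul_of_nonneg_right (hw.codegree y z h) (mul_nonneg (hc3 y) (hc3 z))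
    nlinarith
  have h4 : ∀ x, ∑ y, w x y * (a x ^ 2 * c y ^ 2) ≤
      q * a x ^ 3 + (∑ y, w x y * c y ^ 2) ^ 3 / q ^ 2 := by
    intro x
    have hh : 0 ≤ ∑ y, w x y * c y ^ 2 :=
      Finset.sum_nonneg fun y _ => mul_nonneg (hw.nonneg x y) (sq_nonneg _)
    have e : ∑ y, w x y * (a x ^ 2 * c y ^ 2) = a x ^ 2 * ∑ y, w x y * c y ^ 2 := by
      rw [Finset.mul_sum]; exact Finset.sum_congr rfl fun y _ => by ring
    rw [e]
    generalize ∑ y, w x y * c y ^ 2 = h at *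
    have ha' := ha x
    generalize a x = b at *
    -- A weighted Young inequality: whichever of h and qb is larger absorbs the product.
    rcases le_total h (q * b) with hle | hle
    · have : b ^ 2 * h ≤ b ^ 2 * (q * b) := mul_le_mul_of_nonneg_left hle (sq_nonneg b)
      have : 0 ≤ h ^ 3 / q ^ 2 := by positivity
      nlinarith
    · have h5 : b ^ 2 * h ≤ h ^ 3 / q ^ 2 := by
        rw [le_div_iff₀ (by positivity)]
        have : (q * b) ^ 2 ≤ h ^ 2 := pow_le_pow_left₀ (by positivity) hle 2
        nlinarith
      have : 0 ≤ q * b ^ 3 := by positivity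
      linarith
  calc ∑ x, ∑ y, w x y * (a x ^ 2 * c y ^ 2)
      ≤ ∑ x, (q * a x ^ 3 + (∑ y, w x y * c y ^ 2) ^ 3 / q ^ 2) :=
        Finset.sum_le_sum fun x _ => h4 x
    _ = q * q ^ 2 + (∑ x, (∑ y, w x y * c y ^ 2) ^ 3) / q ^ 2 := by
        rw [Finset.sum_add_distrib, ← Finset.mul_sum, hasum, Finset.sum_div]
    _ ≤ q * q ^ 2 + 24 * q ^ 5 / q ^ 2 := by gcongr
    _ = 25 * q ^ 3 := by field_simp; ring
    _ ≤ 100 * q ^ 3 := by nlinarith [pow_pos hq0 3]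

/-- The estimate for the triangle form with three `L²` functions. -/
theorem sum_triangle_le (hw : IsCodegreeKernel w D) {f g h : V → ℝ}
    {q : ℝ} (hq : 1 ≤ q)
    (hfs : ∑ x, f x ^ 2 = q ^ 2) (hgs : ∑ x, g x ^ 2 = q ^ 2) (hhs : ∑ x, h x ^ 2 = q ^ 2) :
    ∑ z, ∑ x, ∑ y, w z x * w z y * w x y * (f x * g y * h z) ≤ 100 * q ^ 3 := by
  classical
  have hq0 : 0 < q := by linarith
  set k : V → V → V → ℝ := fun z x y => w z x * w z y * w x y with hk
  have hk0 : ∀ z x y, 0 ≤ k z x y := fun z x y =>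
    mul_nonneg (mul_nonneg (hw.nonneg _ _) (hw.nonneg _ _)) (hw.nonneg _ _)
  set r : V → ℝ := fun z => ∑ x, ∑ y, k z x y * (f x * g y) with hr
  set A : V → V → ℝ := fun x y => f x ^ 2 * g y ^ 2 with hA
  have hA0 : ∀ x y, 0 ≤ A x y := fun x y => mul_nonneg (sq_nonneg _) (sq_nonneg _)
  have hAsum : ∑ x, ∑ y, A x y = q ^ 4 := by
    rw [← Finset.sum_mul_sum, hfs, hgs]; ring
  have hky : ∀ z x, ∑ y, k z x y ≤ 2 * w z x := fun z x => by
    have := hw.mul_codegree_le z x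
    simpa only [hk, mul_assoc, ← Finset.mul_sum] using this
  have hkx : ∀ z y, ∑ x, k z x y ≤ 2 * w z y := fun z y => by
    have := hky z y
    refine le_of_eq_of_le (Finset.sum_congr rfl fun x _ => ?_) this
    simp only [hk]; rw [hw.symm x y]; ring
  have hkz : ∀ x y, ∑ z, k z x y ≤ 2 * w x y := fun x y => by
    refine le_of_eq_of_le (Finset.sum_congr rfl fun z _ => ?_) (hky x y)
    simp only [hk]; rw [hw.symm z x, hw.symm z y]; ring
  -- the three contributions to the second moment of `r`
  have S1 : ∑ z, ∑ x₁, ∑ y₂, (∑ y₁, k z x₁ y₁) * (∑ x₂, k z x₂ y₂) *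
      (if x₁ = y₂ then 0 else A x₁ y₂) ≤ 8 * q ^ 4 := by
    have : ∀ z x₁ y₂, (∑ y₁, k z x₁ y₁) * (∑ x₂, k z x₂ y₂) *
        (if x₁ = y₂ then 0 else A x₁ y₂) ≤
        (2 * w z x₁) * (2 * w z y₂) * (if x₁ = y₂ then 0 else A x₁ y₂) := fun z x₁ y₂ =>
      mul_le_mul_of_nonneg_right (mul_le_mul (hky z x₁) (hkx z y₂)
        (Finset.sum_nonneg fun x _ => hk0 _ _ _) (mul_nonneg (by norm_num) (hw.nonneg _ _)))
        (by split_ifs; exacts [le_rfl, hA0 _ _])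
    refine (Finset.sum_le_sum fun z _ => Finset.sum_le_sum fun x _ => Finset.sum_le_sum fun y _ =>
      this z x y).trans ?_
    rw [Finset.sum_comm, ← hAsum, Finset.mul_sum]
    refine Finset.sum_le_sum fun x _ => ?_
    rw [Finset.sum_comm, Finset.mul_sum]
    refine Finset.sum_le_sum fun y _ => ?_
    rw [← Finset.sum_mul]
    split_ifs with h
    · simpa using mul_nonneg (by norm_num : (0:ℝ) ≤ 8) (hA0 x y)
    · refine mul_le_mul_of_nonneg_right ?_ (hA0 x y)
      have e : ∑ z, 2 * w z x * (2 * w z y) = 4 * ∑ z, w x z * w y z := by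
        rw [Finset.mul_sum]
        exact Finset.sum_congr rfl fun z _ => by rw [hw.symm z x, hw.symm z y]; ring
      rw [e]; linarith [hw.codegree x y h]
  have S2 : ∑ z, ∑ x, ∑ y, k z x y * (2 * A x y) ≤ 4 * q ^ 4 := by
    rw [Finset.sum_comm, ← hAsum, Finset.mul_sum]
    refine Finset.sum_le_sum fun x _ => ?_
    rw [Finset.sum_comm, Finset.mul_sum]
    refine Finset.sum_le_sum fun y _ => ?_
    rw [← Finset.sum_mul]
    nlinarith [hkz x y, hw.le_one x y, hA0 x y]
  -- The product of four values has two AM–GM bounds. The crossed pairing A x₁ y₂ + A x₂ y₁ lets z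
  -- be summed by the codegree of x₁ and y₂, but needs x₁ ≠ y₂. When x₁ = y₂ the straight pairing is
  -- used, since the coincidence has already removed a free variable. `B` is one half of this case
  -- distinction; exchanging the indices 1 and 2 gives the other.
  let B : V → V → V → V → ℝ := fun x₁ y₁ x₂ y₂ =>
    (if x₁ = y₂ then 0 else A x₁ y₂) + (if x₁ = y₂ then A x₁ y₁ else 0) +
      (if x₁ = y₂ then A x₂ y₂ else 0)
  have hP : ∀ x₁ y₁ x₂ y₂, (f x₁ * g y₁) * (f x₂ * g y₂) ≤ B x₁ y₁ x₂ y₂ + B x₂ y₂ x₁ y₁ := by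
    intro x₁ y₁ x₂ y₂
    have p1 : (f x₁ * g y₁) * (f x₂ * g y₂) ≤ A x₁ y₁ + A x₂ y₂ := by
      simp only [hA]
      nlinarith [sq_nonneg (f x₁ * g y₁ - f x₂ * g y₂), sq_nonneg (f x₁ * g y₁),
        sq_nonneg (f x₂ * g y₂)]
    have p2 : (f x₁ * g y₁) * (f x₂ * g y₂) ≤ A x₁ y₂ + A x₂ y₁ := by
      simp only [hA]
      nlinarith [sq_nonneg (f x₁ * g y₂ - f x₂ * g y₁), sq_nonneg (f x₁ * g y₂),
        sq_nonneg (f x₂ * g y₁)]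
    have a1 := hA0 x₁ y₁
    have a2 := hA0 x₁ y₂
    have a3 := hA0 x₂ y₁
    have a4 := hA0 x₂ y₂
    simp only [B]
    split_ifs <;> linarith
  have hr2 : ∀ z, r z ^ 2 ≤ 2 * ∑ x₁, ∑ y₁, ∑ x₂, ∑ y₂, k z x₁ y₁ * k z x₂ y₂ *
      B x₁ y₁ x₂ y₂ := by
    intro z
    have e : r z ^ 2 = ∑ x₁, ∑ y₁, ∑ x₂, ∑ y₂, k z x₁ y₁ * k z x₂ y₂ *
        ((f x₁ * g y₁) * (f x₂ * g y₂)) := by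
      rw [sq]
      simp only [hr, Finset.sum_mul, Finset.mul_sum]
      refine Finset.sum_congr rfl fun _ _ => Finset.sum_congr rfl fun _ _ =>
        Finset.sum_congr rfl fun _ _ => Finset.sum_congr rfl fun _ _ => by ring
    have e2 : ∑ x₁, ∑ y₁, ∑ x₂, ∑ y₂, k z x₁ y₁ * k z x₂ y₂ * B x₂ y₂ x₁ y₁ =
        ∑ x₁, ∑ y₁, ∑ x₂, ∑ y₂, k z x₁ y₁ * k z x₂ y₂ * B x₁ y₁ x₂ y₂ := by
      simp only [← Fintype.sum_prod_type' (f := fun x₂ y₂ => k z _ _ * k z x₂ y₂ * B _ _ x₂ y₂),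
        ← Fintype.sum_prod_type' (f := fun x₂ y₂ => k z _ _ * k z x₂ y₂ * B x₂ y₂ _ _),
        ← Fintype.sum_prod_type' (f := fun x₁ y₁ => ∑ p : V × V, k z x₁ y₁ * k z p.1 p.2 *
          B x₁ y₁ p.1 p.2),
        ← Fintype.sum_prod_type' (f := fun x₁ y₁ => ∑ p : V × V, k z x₁ y₁ * k z p.1 p.2 *
          B p.1 p.2 x₁ y₁)]
      rw [Finset.sum_comm]
      exact Finset.sum_congr rfl fun _ _ => Finset.sum_congr rfl fun _ _ => by ring
    rw [e, two_mul]
    nth_rewrite 2 [← e2]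
    simp only [← Finset.sum_add_distrib, ← mul_add]
    exact Finset.sum_le_sum fun _ _ => Finset.sum_le_sum fun _ _ => Finset.sum_le_sum fun _ _ =>
      Finset.sum_le_sum fun _ _ => mul_le_mul_of_nonneg_left (hP _ _ _ _)
        (mul_nonneg (hk0 _ _ _) (hk0 _ _ _))
  have hrB : ∀ z, ∑ x₁, ∑ y₁, ∑ x₂, ∑ y₂, k z x₁ y₁ * k z x₂ y₂ * B x₁ y₁ x₂ y₂ ≤
      ∑ x₁, ∑ y₂, (∑ y₁, k z x₁ y₁) * (∑ x₂, k z x₂ y₂) * (if x₁ = y₂ then 0 else A x₁ y₂) +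
      ∑ x, ∑ y, k z x y * (2 * A x y) + ∑ x, ∑ y, k z x y * (2 * A x y) := by
    intro z
    simp only [B, mul_add, Finset.sum_add_distrib]
    refine add_le_add (add_le_add (le_of_eq ?_) ?_) ?_
    · refine Finset.sum_congr rfl fun x₁ _ => ?_
      rw [Finset.sum_congr rfl fun y₁ _ => Finset.sum_comm, Finset.sum_comm]
      refine Finset.sum_congr rfl fun y₂ _ => ?_
      rw [Finset.sum_mul_sum, Finset.sum_mul]
      exact Finset.sum_congr rfl fun _ _ => by rw [Finset.sum_mul]
    · refine Finset.sum_le_sum fun x₁ _ => Finset.sum_le_sum fun y₁ _ => ?_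
      simp only [mul_ite, mul_zero, Finset.sum_ite_eq, Finset.mem_univ, if_true]
      have : ∑ x₂, k z x₁ y₁ * k z x₂ x₁ * A x₁ y₁ =
          k z x₁ y₁ * A x₁ y₁ * ∑ x₂, k z x₂ x₁ := by
        rw [Finset.mul_sum]; exact Finset.sum_congr rfl fun _ _ => by ring
      rw [this]
      nlinarith [mul_nonneg (hk0 z x₁ y₁) (hA0 x₁ y₁), hkx z x₁, hw.le_one z x₁]
    · have e3 : ∀ x₁ : V, ∑ y₁, ∑ x₂, ∑ y₂, k z x₁ y₁ * k z x₂ y₂ *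
          (if x₁ = y₂ then A x₂ y₂ else 0) = ∑ x₂, k z x₂ x₁ * A x₂ x₁ * ∑ y₁, k z x₁ y₁ := by
        intro x₁
        simp only [mul_ite, mul_zero, Finset.sum_ite_eq, Finset.mem_univ, if_true]
        rw [Finset.sum_comm]
        refine Finset.sum_congr rfl fun _ _ => ?_
        rw [Finset.mul_sum]; exact Finset.sum_congr rfl fun _ _ => by ring
      simp only [e3]
      rw [Finset.sum_comm]
      refine Finset.sum_le_sum fun x₂ _ => Finset.sum_le_sum fun x₁ _ => ?_
      nlinarith [mul_nonneg (hk0 z x₂ x₁) (hA0 x₂ x₁), hky z x₁, hw.le_one z x₁]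
  -- 32 = 2(8 + 4 + 4), from `S1` and two copies of `S2`.
  have hR : ∑ z, r z ^ 2 ≤ 32 * q ^ 4 := by
    calc ∑ z, r z ^ 2 ≤ ∑ z, 2 * (∑ x₁, ∑ y₂, (∑ y₁, k z x₁ y₁) * (∑ x₂, k z x₂ y₂) *
            (if x₁ = y₂ then 0 else A x₁ y₂) +
          ∑ x, ∑ y, k z x y * (2 * A x y) + ∑ x, ∑ y, k z x y * (2 * A x y)) :=
          Finset.sum_le_sum fun z _ => (hr2 z).trans
            (mul_le_mul_of_nonneg_left (hrB z) (by norm_num))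
      _ ≤ 32 * q ^ 4 := by
          rw [← Finset.mul_sum, Finset.sum_add_distrib, Finset.sum_add_distrib]
          linarith
  have hT : ∀ z, ∑ x, ∑ y, w z x * w z y * w x y * (f x * g y * h z) ≤
      q * h z ^ 2 + r z ^ 2 / q := by
    intro z
    have e : ∑ x, ∑ y, w z x * w z y * w x y * (f x * g y * h z) = h z * r z := by
      simp only [hr, Finset.mul_sum]
      exact Finset.sum_congr rfl fun _ _ => Finset.sum_congr rfl fun _ _ => by simp only [hk]; ring
    rw [e]
    have h1 : r z ^ 2 / q = q * (r z / q) ^ 2 := by field_simp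
    have h2 : h z * r z = q * (h z * (r z / q)) := by field_simp
    rw [h1, h2, ← mul_add]
    refine mul_le_mul_of_nonneg_left ?_ hq0.le
    nlinarith [sq_nonneg (h z - r z / q), sq_nonneg (h z), sq_nonneg (r z / q)]
  calc _ ≤ ∑ z, (q * h z ^ 2 + r z ^ 2 / q) := Finset.sum_le_sum fun z _ => hT z
    _ = q * q ^ 2 + (∑ z, r z ^ 2) / q := by
        rw [Finset.sum_add_distrib, ← Finset.mul_sum, hhs, Finset.sum_div]
    _ ≤ q * q ^ 2 + 32 * q ^ 4 / q := by gcongr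
    _ = 33 * q ^ 3 := by field_simp; ring
    _ ≤ 100 * q ^ 3 := by nlinarith [pow_pos hq0 3]

end IsCodegreeKernel

/-! ### Reduction of the exponents to the vertices of a polytope -/

/-- A monomial in three variables is bounded by any number `M ≥ 1` that bounds the monomials with
exponents `(1, 0, 0)`, `(2/3, 2/3, 0)` and `(1/2, 1/2, 1/2)`, for decreasing exponents. -/
theorem rpow_monomial_le_of_antitone {X Y Z a b c M : ℝ} (hX : 0 ≤ X) (hY : 0 ≤ Y) (hZ : 0 ≤ Z)
    (hc : 0 ≤ c) (hcb : c ≤ b) (hba : b ≤ a) (h : 2 * a + b + c ≤ 2) (h1 : 1 ≤ M) (hXM : X ≤ M)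
    (hXY : (X ^ (1 / 3 : ℝ)) ^ 2 * (Y ^ (1 / 3 : ℝ)) ^ 2 ≤ M)
    (hXYZ : X ^ (1 / 2 : ℝ) * Y ^ (1 / 2 : ℝ) * Z ^ (1 / 2 : ℝ) ≤ M) :
    X ^ a * Y ^ b * Z ^ c ≤ M := by
  have half : ∀ {W : ℝ}, 0 ≤ W → (W ^ (1 / 2 : ℝ)) ^ (2 * c) = W ^ c := fun {W} hW => by
    rw [← Real.rpow_mul hW]; congr 1; ring
  have third : ∀ {W : ℝ}, 0 ≤ W → ((W ^ (1 / 3 : ℝ)) ^ 2) ^ (3 / 2 * (b - c)) = W ^ (b - c) :=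
    fun {W} hW => by
      rw [← Real.rpow_natCast, ← Real.rpow_mul hW, ← Real.rpow_mul hW]
      congr 1; push_cast; ring
  -- (a, b, c) = 2c (1/2, 1/2, 1/2) + (3/2)(b − c)(2/3, 2/3, 0) + (a − b)(1, 0, 0). The weights add
  -- up to a + (b + c)/2 ≤ 1, and `1 ≤ M` absorbs the missing weight.
  have e : X ^ a * Y ^ b * Z ^ c =
      (X ^ (1 / 2 : ℝ) * Y ^ (1 / 2 : ℝ) * Z ^ (1 / 2 : ℝ)) ^ (2 * c) *
        ((X ^ (1 / 3 : ℝ)) ^ 2 * (Y ^ (1 / 3 : ℝ)) ^ 2) ^ (3 / 2 * (b - c)) * X ^ (a - b) := by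
    rw [Real.mul_rpow (by positivity) (by positivity), Real.mul_rpow (by positivity)
      (by positivity), Real.mul_rpow (by positivity) (by positivity), half hX, half hY, half hZ,
      third hX, third hY]
    have ea : X ^ a = X ^ c * X ^ (b - c) * X ^ (a - b) := by
      rw [← Real.rpow_add_of_nonneg hX hc (by linarith),
        ← Real.rpow_add_of_nonneg hX (by linarith) (by linarith)]
      congr 1; ring
    have eb : Y ^ b = Y ^ c * Y ^ (b - c) := by
      rw [← Real.rpow_add_of_nonneg hY hc (by linarith)]; congr 1; ring
    rw [ea, eb]; ring
  have hM : 0 < M := by linarith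
  rw [e]
  calc _ ≤ M ^ (2 * c) * M ^ (3 / 2 * (b - c)) * M ^ (a - b) := by
        gcongr
    _ = M ^ (2 * c + 3 / 2 * (b - c) + (a - b)) := by
        rw [Real.rpow_add hM, Real.rpow_add hM]
    _ ≤ M ^ (1 : ℝ) := Real.rpow_le_rpow_of_exponent_le h1 (by linarith)
    _ = M := Real.rpow_one M

/-- The sum of the monomials at the vertices of the region of admissible exponents. -/
def vertexSum (X Y Z : ℝ) : ℝ :=
  1 + X + Y + Z + (X ^ (1 / 3 : ℝ)) ^ 2 * (Y ^ (1 / 3 : ℝ)) ^ 2 +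
    (X ^ (1 / 3 : ℝ)) ^ 2 * (Z ^ (1 / 3 : ℝ)) ^ 2 + (Y ^ (1 / 3 : ℝ)) ^ 2 * (Z ^ (1 / 3 : ℝ)) ^ 2 +
    X ^ (1 / 2 : ℝ) * Y ^ (1 / 2 : ℝ) * Z ^ (1 / 2 : ℝ)

theorem rpow_monomial_le_vertexSum {X Y Z a b c : ℝ} (hX : 0 ≤ X) (hY : 0 ≤ Y) (hZ : 0 ≤ Z)
    (ha : 0 ≤ a) (hb : 0 ≤ b) (hc : 0 ≤ c) (h1 : 2 * a + b + c ≤ 2) (h2 : a + 2 * b + c ≤ 2)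
    (h3 : a + b + 2 * c ≤ 2) : X ^ a * Y ^ b * Z ^ c ≤ vertexSum X Y Z := by
  have p1 : 0 ≤ (X ^ (1 / 3 : ℝ)) ^ 2 * (Y ^ (1 / 3 : ℝ)) ^ 2 := by positivity
  have p2 : 0 ≤ (X ^ (1 / 3 : ℝ)) ^ 2 * (Z ^ (1 / 3 : ℝ)) ^ 2 := by positivity
  have p3 : 0 ≤ (Y ^ (1 / 3 : ℝ)) ^ 2 * (Z ^ (1 / 3 : ℝ)) ^ 2 := by positivity
  have p4 : 0 ≤ X ^ (1 / 2 : ℝ) * Y ^ (1 / 2 : ℝ) * Z ^ (1 / 2 : ℝ) := by positivity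
  obtain ⟨M, hM⟩ : ∃ M, M = vertexSum X Y Z := ⟨_, rfl⟩
  rw [← hM]
  unfold vertexSum at hM
  have m0 : 1 ≤ M := by linarith
  have mX : X ≤ M := by linarith
  have mY : Y ≤ M := by linarith
  have mZ : Z ≤ M := by linarith
  have mXY : (X ^ (1 / 3 : ℝ)) ^ 2 * (Y ^ (1 / 3 : ℝ)) ^ 2 ≤ M := by linarith
  have mXZ : (X ^ (1 / 3 : ℝ)) ^ 2 * (Z ^ (1 / 3 : ℝ)) ^ 2 ≤ M := by linarith
  have mYZ : (Y ^ (1 / 3 : ℝ)) ^ 2 * (Z ^ (1 / 3 : ℝ)) ^ 2 ≤ M := by linarith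
  have mXYZ : X ^ (1 / 2 : ℝ) * Y ^ (1 / 2 : ℝ) * Z ^ (1 / 2 : ℝ) ≤ M := by linarith
  clear hM
  rcases le_total a b with hab | hab <;> rcases le_total b c with hbc | hbc
  · rw [show X ^ a * Y ^ b * Z ^ c = Z ^ c * Y ^ b * X ^ a by ring]
    exact rpow_monomial_le_of_antitone hZ hY hX ha hab hbc (by linarith) m0 mZ
      (by rwa [mul_comm]) (le_of_eq_of_le (by ring) mXYZ)
  · rcases le_total a c with hac | hac
    · rw [show X ^ a * Y ^ b * Z ^ c = Y ^ b * Z ^ c * X ^ a by ring]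
      exact rpow_monomial_le_of_antitone hY hZ hX ha hac hbc (by linarith) m0 mY
        mYZ (le_of_eq_of_le (by ring) mXYZ)
    · rw [show X ^ a * Y ^ b * Z ^ c = Y ^ b * X ^ a * Z ^ c by ring]
      exact rpow_monomial_le_of_antitone hY hX hZ hc hac hab (by linarith) m0 mY
        (by rwa [mul_comm]) (le_of_eq_of_le (by ring) mXYZ)
  · rcases le_total a c with hac | hac
    · rw [show X ^ a * Y ^ b * Z ^ c = Z ^ c * X ^ a * Y ^ b by ring]
      exact rpow_monomial_le_of_antitone hZ hX hY hb hab hac (by linarith) m0 mZ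
        (by rwa [mul_comm]) (le_of_eq_of_le (by ring) mXYZ)
    · rw [show X ^ a * Y ^ b * Z ^ c = X ^ a * Z ^ c * Y ^ b by ring]
      exact rpow_monomial_le_of_antitone hX hZ hY hb hbc hac (by linarith) m0 mX
        mXZ (le_of_eq_of_le (by ring) mXYZ)
  · exact rpow_monomial_le_of_antitone hX hY hZ hc hbc hab (by linarith) m0 mX mXY mXYZ

/-! ### Triangle and diamond sums for kernels of bounded codegree -/

namespace IsCodegreeKernel

variable {V : Type*} [Fintype V] {w : V → V → ℝ} {D : ℝ}

/-- The vertex on which φ does not depend is a common neighbour of the other two, so summing over it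
costs a factor 2. -/
theorem triangle_fst_snd_le (hw : IsCodegreeKernel w D) {φ : V → V → ℝ} (hφ : ∀ x y, 0 ≤ φ x y) :
    ∑ x, ∑ y, ∑ z, w x y * w x z * w y z * φ x y ≤ 2 * ∑ x, ∑ y, w x y * φ x y := by
  simp only [Finset.mul_sum]
  refine Finset.sum_le_sum fun x _ => Finset.sum_le_sum fun y _ => ?_
  have e : ∑ z, w x y * w x z * w y z * φ x y = (w x y * ∑ z, w x z * w y z) * φ x y := by
    rw [Finset.mul_sum, Finset.sum_mul]; exact Finset.sum_congr rfl fun _ _ => by ring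
  rw [e, ← mul_assoc]
  exact mul_le_mul_of_nonneg_right (hw.mul_codegree_le x y) (hφ x y)

theorem triangle_fst_thd_le (hw : IsCodegreeKernel w D) {φ : V → V → ℝ} (hφ : ∀ x y, 0 ≤ φ x y) :
    ∑ x, ∑ y, ∑ z, w x y * w x z * w y z * φ x z ≤ 2 * ∑ x, ∑ z, w x z * φ x z := by
  refine le_of_eq_of_le (Finset.sum_congr rfl fun x _ => ?_) (hw.triangle_fst_snd_le hφ)
  rw [Finset.sum_comm]
  exact Finset.sum_congr rfl fun y _ => Finset.sum_congr rfl fun z _ => by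
    rw [hw.symm z y]; ring

theorem triangle_snd_thd_le (hw : IsCodegreeKernel w D) {φ : V → V → ℝ} (hφ : ∀ x y, 0 ≤ φ x y) :
    ∑ x, ∑ y, ∑ z, w x y * w x z * w y z * φ y z ≤ 2 * ∑ y, ∑ z, w y z * φ y z := by
  refine le_of_eq_of_le ?_ (hw.triangle_fst_thd_le hφ)
  rw [Finset.sum_comm]
  exact Finset.sum_congr rfl fun y _ => Finset.sum_congr rfl fun x _ =>
    Finset.sum_congr rfl fun z _ => by rw [hw.symm x y]; ring

theorem triangle_vertexSum_le (hw : IsCodegreeKernel w D) {F G H : V → ℝ} (hF : ∀ x, 0 ≤ F x)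
    (hG : ∀ x, 0 ≤ G x) (hH : ∀ x, 0 ≤ H x) {q : ℝ} (hq : 1 ≤ q) (hDq : D ≤ 2 * q)
    (hV : (Fintype.card V : ℝ) = q ^ 2)
    (hFs : ∑ x, F x = q ^ 2) (hGs : ∑ x, G x = q ^ 2) (hHs : ∑ x, H x = q ^ 2) :
    ∑ x, ∑ y, ∑ z, w x y * w x z * w y z * vertexSum (F x) (G y) (H z) ≤ 1000 * q ^ 3 := by
  have hq0 : 0 < q := by linarith
  have deg : ∀ {f : V → ℝ}, (∀ x, 0 ≤ f x) → ∑ x, f x = q ^ 2 →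
      ∑ x, ∑ y, w x y * f y ≤ 2 * q ^ 3 := fun {f} hf hfs => by
    have := hw.sum_degree_mul_le hf
    rw [hfs] at this
    nlinarith [sq_nonneg q]
  have deg' : ∀ {f : V → ℝ}, (∀ x, 0 ≤ f x) → ∑ x, f x = q ^ 2 →
      ∑ x, ∑ y, w x y * f x ≤ 2 * q ^ 3 := fun {f} hf hfs => by
    rw [Finset.sum_comm]; simpa only [hw.symm] using deg hf hfs
  have cube : ∀ {W : ℝ}, 0 ≤ W → (W ^ (1 / 3 : ℝ)) ^ 3 = W := fun {W} hW => by
    rw [← Real.rpow_natCast, ← Real.rpow_mul hW]; norm_num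
  have square : ∀ {W : ℝ}, 0 ≤ W → (W ^ (1 / 2 : ℝ)) ^ 2 = W := fun {W} hW => by
    rw [← Real.rpow_natCast, ← Real.rpow_mul hW]; norm_num
  have edge : ∀ {f g : V → ℝ}, (∀ x, 0 ≤ f x) → (∀ x, 0 ≤ g x) → ∑ x, f x = q ^ 2 →
      ∑ x, g x = q ^ 2 →
      ∑ x, ∑ y, w x y * ((f x ^ (1 / 3 : ℝ)) ^ 2 * (g y ^ (1 / 3 : ℝ)) ^ 2) ≤ 100 * q ^ 3 :=
    fun {f g} hf hg hfs hgs =>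
      hw.sum_edge_le (a := fun x => f x ^ (1 / 3 : ℝ)) (c := fun x => g x ^ (1 / 3 : ℝ))
        (fun x => Real.rpow_nonneg (hf x) _) (fun x => Real.rpow_nonneg (hg x) _) hq hDq
        (by simpa only [cube (hf _)] using hfs) (by simpa only [cube (hg _)] using hgs)
  have t0 := hw.triangle_fst_snd_le (φ := fun _ _ => 1) fun _ _ => zero_le_one
  have d0 := deg (f := fun _ => 1) (fun _ => zero_le_one) (by simpa using hV)
  have t1 := hw.triangle_fst_snd_le (φ := fun x _ => F x) fun x _ => hF x
  have t2 := hw.triangle_fst_snd_le (φ := fun _ y => G y) fun _ y => hG y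
  have t3 := hw.triangle_fst_thd_le (φ := fun _ z => H z) fun _ z => hH z
  have t4 := hw.triangle_fst_snd_le
    (φ := fun x y => (F x ^ (1 / 3 : ℝ)) ^ 2 * (G y ^ (1 / 3 : ℝ)) ^ 2) fun _ _ => by positivity
  have t5 := hw.triangle_fst_thd_le
    (φ := fun x y => (F x ^ (1 / 3 : ℝ)) ^ 2 * (H y ^ (1 / 3 : ℝ)) ^ 2) fun _ _ => by positivity
  have t6 := hw.triangle_snd_thd_le
    (φ := fun x y => (G x ^ (1 / 3 : ℝ)) ^ 2 * (H y ^ (1 / 3 : ℝ)) ^ 2) fun _ _ => by positivity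
  have t7 := hw.sum_triangle_le (f := fun x => G x ^ (1 / 2 : ℝ)) (g := fun x => H x ^ (1 / 2 : ℝ))
    (h := fun x => F x ^ (1 / 2 : ℝ)) hq (by simpa only [square (hG _)] using hGs)
    (by simpa only [square (hH _)] using hHs) (by simpa only [square (hF _)] using hFs)
  have e7 : ∑ x, ∑ y, ∑ z, w x y * w x z * w y z *
      (F x ^ (1 / 2 : ℝ) * G y ^ (1 / 2 : ℝ) * H z ^ (1 / 2 : ℝ)) ≤ 100 * q ^ 3 := by
    refine le_of_eq_of_le ?_ t7
    exact Finset.sum_congr rfl fun _ _ => Finset.sum_congr rfl fun _ _ =>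
      Finset.sum_congr rfl fun _ _ => by ring
  simp only [vertexSum, mul_add, Finset.sum_add_distrib]
  have d1 := deg' hF hFs
  have d2 := deg hG hGs
  have d3 := deg hH hHs
  have d4 := edge hF hG hFs hGs
  have d5 := edge hF hH hFs hHs
  have d6 := edge hG hH hGs hHs
  have := pow_pos hq0 3
  linarith

/-- The sum over the `4`-cycle with a diagonal of a function of `x₁, x₂, x₃`. -/
theorem diamond_sum_le (hw : IsCodegreeKernel w D) {φ : V → V → V → ℝ}
    (hφ : ∀ x y z, 0 ≤ φ x y z) :
    ∑ x₁, ∑ x₂, ∑ x₃, ∑ x₄, w x₁ x₂ * w x₂ x₃ * w x₃ x₄ * w x₄ x₁ * w x₁ x₃ * φ x₁ x₂ x₃ ≤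
      2 * ∑ x₁, ∑ x₂, ∑ x₃, w x₁ x₂ * w x₁ x₃ * w x₂ x₃ * φ x₁ x₂ x₃ := by
  simp only [Finset.mul_sum]
  refine Finset.sum_le_sum fun x₁ _ => Finset.sum_le_sum fun x₂ _ =>
    Finset.sum_le_sum fun x₃ _ => ?_
  have e : ∑ x₄, w x₁ x₂ * w x₂ x₃ * w x₃ x₄ * w x₄ x₁ * w x₁ x₃ * φ x₁ x₂ x₃ =
      (w x₁ x₃ * ∑ x₄, w x₁ x₄ * w x₃ x₄) * (w x₁ x₂ * w x₂ x₃ * φ x₁ x₂ x₃) := by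
    rw [Finset.mul_sum, Finset.sum_mul]
    exact Finset.sum_congr rfl fun x₄ _ => by rw [hw.symm x₄ x₁]; ring
  rw [e]
  refine (mul_le_mul_of_nonneg_right (hw.mul_codegree_le x₁ x₃)
    (mul_nonneg (mul_nonneg (hw.nonneg _ _) (hw.nonneg _ _)) (hφ _ _ _))).trans_eq (by ring)

theorem diamond_rpow_le (hw : IsCodegreeKernel w D) {g₁ g₂ g₃ g₄ : V → ℝ}
    (h₁ : ∀ x, 0 ≤ g₁ x) (h₂ : ∀ x, 0 ≤ g₂ x) (h₃ : ∀ x, 0 ≤ g₃ x) (h₄ : ∀ x, 0 ≤ g₄ x)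
    {q : ℝ} (hq : 1 ≤ q) (hDq : D ≤ 2 * q) (hV : (Fintype.card V : ℝ) = q ^ 2)
    (s₁ : ∑ x, g₁ x = q ^ 2) (s₂ : ∑ x, g₂ x = q ^ 2) (s₃ : ∑ x, g₃ x = q ^ 2)
    (s₄ : ∑ x, g₄ x = q ^ 2) {a₁ a₂ a₃ a₄ : ℝ} (n₁ : 0 ≤ a₁) (n₂ : 0 ≤ a₂) (n₃ : 0 ≤ a₃)
    (n₄ : 0 ≤ a₄) (c₁ : a₁ + a₂ + 2 * a₃ + a₄ ≤ 2) (c₂ : 2 * a₁ + a₂ + a₃ + a₄ ≤ 2)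
    (c₃ : a₁ + 2 * a₂ + a₃ + 2 * a₄ ≤ 2) :
    ∑ x₁, ∑ x₂, ∑ x₃, ∑ x₄, w x₁ x₂ * w x₂ x₃ * w x₃ x₄ * w x₄ x₁ * w x₁ x₃ *
      (g₁ x₁ ^ a₁ * g₂ x₂ ^ a₂ * g₃ x₃ ^ a₃ * g₄ x₄ ^ a₄) ≤ 4000 * q ^ 3 := by
  have vs0 : ∀ {X Y Z : ℝ}, 0 ≤ X → 0 ≤ Y → 0 ≤ Z → 0 ≤ vertexSum X Y Z := fun hX hY hZ => by
    unfold vertexSum; positivity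
  -- The larger of Y and W absorbs the other, so the factors at the two opposite vertices 2 and 4
  -- never have to be handled together.
  have merge : ∀ {Y W : ℝ}, 0 ≤ Y → 0 ≤ W → Y ^ a₂ * W ^ a₄ ≤ Y ^ (a₂ + a₄) + W ^ (a₂ + a₄) := by
    intro Y W hY hW
    rw [Real.rpow_add_of_nonneg hY n₂ n₄, Real.rpow_add_of_nonneg hW n₂ n₄]
    have y2 := Real.rpow_nonneg hY a₂
    have y4 := Real.rpow_nonneg hY a₄
    have w2 := Real.rpow_nonneg hW a₂
    have w4 := Real.rpow_nonneg hW a₄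
    rcases le_total Y W with h | h
    · nlinarith [Real.rpow_le_rpow hY h n₂, mul_nonneg y2 y4]
    · nlinarith [Real.rpow_le_rpow hW h n₄, mul_nonneg w2 w4]
  have point : ∀ x₁ x₂ x₃ x₄, g₁ x₁ ^ a₁ * g₂ x₂ ^ a₂ * g₃ x₃ ^ a₃ * g₄ x₄ ^ a₄ ≤
      vertexSum (g₁ x₁) (g₂ x₂) (g₃ x₃) + vertexSum (g₁ x₁) (g₄ x₄) (g₃ x₃) := by
    intro x₁ x₂ x₃ x₄
    have m1 := rpow_monomial_le_vertexSum (h₁ x₁) (h₂ x₂) (h₃ x₃) n₁ (add_nonneg n₂ n₄) n₃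
      (by linarith) (by linarith) (by linarith)
    have m2 := rpow_monomial_le_vertexSum (h₁ x₁) (h₄ x₄) (h₃ x₃) n₁ (add_nonneg n₂ n₄) n₃
      (by linarith) (by linarith) (by linarith)
    have m3 := mul_le_mul_of_nonneg_left (merge (h₂ x₂) (h₄ x₄))
      (mul_nonneg (Real.rpow_nonneg (h₁ x₁) a₁) (Real.rpow_nonneg (h₃ x₃) a₃))
    nlinarith
  have k0 : ∀ x₁ x₂ x₃ x₄, 0 ≤ w x₁ x₂ * w x₂ x₃ * w x₃ x₄ * w x₄ x₁ * w x₁ x₃ :=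
    fun x₁ x₂ x₃ x₄ => by
      have := hw.nonneg
      exact mul_nonneg (mul_nonneg (mul_nonneg (mul_nonneg (this _ _) (this _ _)) (this _ _))
        (this _ _)) (this _ _)
  have T₂ := (hw.diamond_sum_le fun x y z => vs0 (h₁ x) (h₂ y) (h₃ z)).trans
    (mul_le_mul_of_nonneg_left (hw.triangle_vertexSum_le h₁ h₂ h₃ hq hDq hV s₁ s₂ s₃) two_pos.le)
  have T₄ := (hw.diamond_sum_le fun x y z => vs0 (h₁ x) (h₄ y) (h₃ z)).trans
    (mul_le_mul_of_nonneg_left (hw.triangle_vertexSum_le h₁ h₄ h₃ hq hDq hV s₁ s₄ s₃) two_pos.le)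
  -- Reflecting the diamond in its diagonal exchanges x₂ and x₄.
  have swap : ∑ x₁, ∑ x₂, ∑ x₃, ∑ x₄, w x₁ x₂ * w x₂ x₃ * w x₃ x₄ * w x₄ x₁ * w x₁ x₃ *
        vertexSum (g₁ x₁) (g₄ x₄) (g₃ x₃) =
      ∑ x₁, ∑ x₂, ∑ x₃, ∑ x₄, w x₁ x₂ * w x₂ x₃ * w x₃ x₄ * w x₄ x₁ * w x₁ x₃ *
        vertexSum (g₁ x₁) (g₄ x₂) (g₃ x₃) := by
    refine Finset.sum_congr rfl fun x₁ _ => ?_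
    rw [Finset.sum_comm, Finset.sum_comm (s := Finset.univ (α := V))]
    conv_lhs => rw [Finset.sum_comm]
    conv_rhs => rw [Finset.sum_comm]
    refine Finset.sum_congr rfl fun x₃ _ => ?_
    rw [Finset.sum_comm]
    refine Finset.sum_congr rfl fun x₂ _ => Finset.sum_congr rfl fun x₄ _ => ?_
    rw [hw.symm x₁ x₄, hw.symm x₄ x₃, hw.symm x₃ x₂, hw.symm x₂ x₁]; ring
  calc _ ≤ ∑ x₁, ∑ x₂, ∑ x₃, ∑ x₄, w x₁ x₂ * w x₂ x₃ * w x₃ x₄ * w x₄ x₁ * w x₁ x₃ *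
        (vertexSum (g₁ x₁) (g₂ x₂) (g₃ x₃) + vertexSum (g₁ x₁) (g₄ x₄) (g₃ x₃)) :=
        Finset.sum_le_sum fun _ _ => Finset.sum_le_sum fun _ _ => Finset.sum_le_sum fun _ _ =>
          Finset.sum_le_sum fun _ _ => mul_le_mul_of_nonneg_left (point _ _ _ _) (k0 _ _ _ _)
    _ ≤ 4000 * q ^ 3 := by
        simp only [mul_add, Finset.sum_add_distrib]
        rw [swap]
        linarith

end IsCodegreeKernel

/-! ### Circles in the plane over a finite field, and the upper bound for the form -/

section Geometry

variable {F : Type} [Field F]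

theorem quadNorm_eq (x : Fin 2 → F) : quadNorm x = x 0 ^ 2 + x 1 ^ 2 := by
  simp [quadNorm, Fin.sum_univ_two]

theorem quadNorm_smul (c : F) (x : Fin 2 → F) : quadNorm (c • x) = c ^ 2 * quadNorm x := by
  simp only [quadNorm_eq, Pi.smul_apply, smul_eq_mul]; ring

theorem circleInd_of_eq {t : F} {x : Fin 2 → F} (h : quadNorm x = t) : circleInd t x = 1 :=
  Set.indicator_of_mem (s := circle t) h 1

theorem circleInd_of_ne {t : F} {x : Fin 2 → F} (h : quadNorm x ≠ t) : circleInd t x = 0 :=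
  Set.indicator_of_notMem (s := circle t) h 1

theorem circleInd_nonneg (t : F) (x : Fin 2 → F) : 0 ≤ circleInd t x :=
  Set.indicator_nonneg (fun _ _ => zero_le_one) x

theorem circleInd_le_one (t : F) (x : Fin 2 → F) : circleInd t x ≤ 1 :=
  Set.indicator_le_self' (fun _ _ => zero_le_one) x

theorem card_le_two_of_sq_eq {α : Type*} {s : Finset α} {f : α → F} {c : F}
    (hinj : Set.InjOn f s) (hf : ∀ x ∈ s, f x ^ 2 = c) : s.card ≤ 2 := by
  by_contra! h
  obtain ⟨x, y, z, hx, hy, hz, hxy, hxz, hyz⟩ := Finset.two_lt_card_iff.mp h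
  have neg : ∀ {u v}, u ∈ s → v ∈ s → u ≠ v → f u = -f v := fun hu hv huv =>
    (sq_eq_sq_iff_eq_or_eq_neg.mp ((hf _ hu).trans (hf _ hv).symm)).resolve_left
      fun e => huv (hinj hu hv e)
  exact hyz (hinj hy hz (neg_injective ((neg hx hy hxy).symm.trans (neg hx hz hxz))))

variable [Fintype F]

theorem sum_circleInd (t : F) : ∑ v, circleInd t v = ((circle t).ncard : ℝ) := by
  classical
  rw [Set.ncard_eq_toFinset_card']
  simp [circleInd, Set.indicator_apply]

theorem ncard_circle_le (t : F) : ((circle t).ncard : ℝ) ≤ 2 * Fintype.card F := by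
  classical
  rw [Set.ncard_eq_toFinset_card']
  have h := Finset.card_le_mul_card_image (f := fun v : Fin 2 → F => v 0) (circle t).toFinset 2
    (fun b _ => card_le_two_of_sq_eq (f := fun v : Fin 2 → F => v 1) (c := t - b ^ 2)
      (by
        intro x hx y hy hxy
        simp only [Finset.coe_filter, Set.mem_ofPred_eq] at hx hy
        ext i; fin_cases i
        · exact hx.2.trans hy.2.symm
        · exact hxy)
      (by
        intro x hx
        simp only [Finset.mem_filter, Set.mem_toFinset] at hx
        have := hx.1
        simp only [circle, Set.mem_ofPred_eq, quadNorm_eq] at this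
        rw [← this, ← hx.2]; ring))
  have h2 := Finset.card_le_univ ((circle t).toFinset.image fun v : Fin 2 → F => v 0)
  exact_mod_cast h.trans (Nat.mul_le_mul_left 2 h2)

/-- Two distinct circles of the same nonzero radius meet in at most two points. -/
theorem sum_circleInd_mul_le {t : F} (ht : t ≠ 0) (h2 : (2 : F) ≠ 0) {x y : Fin 2 → F}
    (hxy : x ≠ y) : ∑ z, circleInd t (x - z) * circleInd t (y - z) ≤ 2 := by
  classical
  set s : Finset (Fin 2 → F) :=
    Finset.univ.filter fun z => quadNorm (x - z) = t ∧ quadNorm (y - z) = t with hs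
  have e : ∑ z, circleInd t (x - z) * circleInd t (y - z) = s.card := by
    rw [hs, Finset.card_filter, Nat.cast_sum]
    refine Finset.sum_congr rfl fun z _ => ?_
    by_cases h₁ : quadNorm (x - z) = t <;> by_cases h₂ : quadNorm (y - z) = t <;>
      simp [h₁, h₂, circleInd_of_eq, circleInd_of_ne]
  rw [e]
  set u₀ : F := y 0 - x 0 with hu₀
  set u₁ : F := y 1 - x 1 with hu₁
  set n : F := u₀ ^ 2 + u₁ ^ 2 with hn
  have hu : ¬(u₀ = 0 ∧ u₁ = 0) := fun h => hxy <| by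
    ext i; fin_cases i
    · exact (sub_eq_zero.mp h.1).symm
    · exact (sub_eq_zero.mp h.2).symm
  have mem₁ : ∀ z ∈ s, (x 0 - z 0) ^ 2 + (x 1 - z 1) ^ 2 = t := fun z hz => by
    have := (Finset.mem_filter.mp hz).2.1
    rwa [quadNorm_eq] at this
  have mem₂ : ∀ z ∈ s, u₀ * (x 0 - z 0) + u₁ * (x 1 - z 1) = -(n / 2) := fun z hz => by
    have h₂ := (Finset.mem_filter.mp hz).2.2
    rw [quadNorm_eq] at h₂
    simp only [Pi.sub_apply] at h₂
    refine mul_left_cancel₀ h2 ?_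
    rw [mul_neg, mul_div_cancel₀ _ h2]
    linear_combination h₂ - mem₁ z hz
  -- With u = y − x and v = x − z this is Lagrange's identity (u·v)² + (u×v)² = ‖u‖‖v‖.
  have mem₃ : ∀ z ∈ s, (u₀ * (x 1 - z 1) - u₁ * (x 0 - z 0)) ^ 2 = n * t - (n / 2) ^ 2 :=
    fun z hz => by
      linear_combination n * mem₁ z hz -
        (u₀ * (x 0 - z 0) + u₁ * (x 1 - z 1) - n / 2) * mem₂ z hz
  -- If u were isotropic, its dot and cross products with v would both vanish, forcing t u = 0.
  have hn0 : ∀ z ∈ s, n ≠ 0 := fun z hz h0 => hu <| by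
    have m₁ := mem₁ z hz
    have m₂ := mem₂ z hz
    have m₃ := mem₃ z hz
    simp only [h0, zero_div, neg_zero, zero_mul, zero_pow two_ne_zero, sub_zero] at m₂ m₃
    have m₃ := pow_eq_zero_iff two_ne_zero |>.mp m₃
    constructor
    · refine (mul_eq_zero.mp ?_).resolve_right ht
      linear_combination (x 0 - z 0) * m₂ + (x 1 - z 1) * m₃ - u₀ * m₁
    · refine (mul_eq_zero.mp ?_).resolve_right ht
      linear_combination (x 1 - z 1) * m₂ - (x 0 - z 0) * m₃ - u₁ * m₁
  -- The dot product being fixed and n nonzero, the cross product determines z, and its square is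
  -- prescribed.
  exact_mod_cast card_le_two_of_sq_eq (f := fun z : Fin 2 → F => u₀ * (x 1 - z 1) - u₁ * (x 0 - z 0))
    (by
      intro z hz z' hz' hzz
      simp only at hzz
      have d := (mem₂ z hz).trans (mem₂ z' hz').symm
      ext i; fin_cases i
      · refine mul_left_cancel₀ (hn0 z hz) ?_
        change n * z 0 = n * z' 0
        linear_combination (-u₀) * d + u₁ * hzz
      · refine mul_left_cancel₀ (hn0 z hz) ?_
        change n * z 1 = n * z' 1
        linear_combination (-u₁) * d - u₀ * hzz) mem₃

theorem isCodegreeKernel_circleInd {t : F} (ht : t ≠ 0) (h2 : (2 : F) ≠ 0) :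
    IsCodegreeKernel (fun x y : Fin 2 → F => circleInd t (x - y)) (2 * Fintype.card F) where
  nonneg _ _ := circleInd_nonneg _ _
  le_one _ _ := circleInd_le_one _ _
  symm x y := by
    have : quadNorm (x - y) = quadNorm (y - x) := by
      simp only [quadNorm_eq, Pi.sub_apply]; ring
    by_cases h : quadNorm (x - y) = t
    · rw [circleInd_of_eq h, circleInd_of_eq (this ▸ h)]
    · rw [circleInd_of_ne h, circleInd_of_ne (this ▸ h)]
  irrefl x := circleInd_of_ne (by simpa [quadNorm_eq] using ht.symm)
  degree x := by
    refine le_of_eq_of_le ?_ (ncard_circle_le t)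
    rw [← sum_circleInd]
    exact (Equiv.subLeft x).sum_comp (circleInd t)
  codegree _ _ := sum_circleInd_mul_le ht h2

/-- A circle of nonzero radius with a rational point has at least `q / 3` points, by rational
parametrization. -/
theorem card_le_ncard_circle {t : F} (ht : t ≠ 0) (h2 : (2 : F) ≠ 0) (hne : (circle t).Nonempty) :
    (Fintype.card F : ℝ) ≤ 3 * (circle t).ncard := by
  classical
  obtain ⟨p, hp⟩ := hne
  simp only [circle, Set.mem_ofPred_eq, quadNorm_eq] at hp
  have hq : 3 ≤ Fintype.card F := by
    have h1 : 1 < Fintype.card F := Fintype.one_lt_card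
    by_contra! h
    have h3 : Fintype.card F = 2 := by omega
    exact h2 (by have := Nat.cast_card_eq_zero F; rw [h3] at this; exact_mod_cast this)
  set s : Finset F := Finset.univ.filter fun m => m ^ 2 = -1 with hs
  have hs2 : s.card ≤ 2 := card_le_two_of_sq_eq (f := id) (c := -1) Function.injective_id.injOn
    fun m hm => (Finset.mem_filter.mp hm).2
  have hsc : sᶜ.card = Fintype.card F - s.card := Finset.card_compl s
  have hm0 : ∀ m ∈ sᶜ, 1 + m ^ 2 ≠ 0 := fun m hm h => by
    rw [Finset.mem_compl, hs, Finset.mem_filter] at hm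
    exact hm ⟨Finset.mem_univ _, by linear_combination h⟩
  have hle : sᶜ.card ≤ (circle t).toFinset.card := by
    -- The point p is moved by the rotation (1 − m², 2m)/(1 + m²). At most two m, those with m² =
    -- −1, are excluded, and q − 2 ≥ q/3 because q ≥ 3.
    refine Finset.card_le_card_of_injOn
      (fun m => ![((1 - m ^ 2) * p 0 - 2 * m * p 1) / (1 + m ^ 2),
        (2 * m * p 0 + (1 - m ^ 2) * p 1) / (1 + m ^ 2)]) (fun m hm => ?_) ?_
    · have := hm0 m hm
      refine Finset.mem_coe.mpr (Set.mem_toFinset.mpr ?_)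
      change quadNorm _ = t
      rw [← hp, quadNorm_eq]
      simp only [Matrix.cons_val_zero, Matrix.cons_val_one]
      field_simp
      ring
    · intro m hm m' hm' h
      have k := hm0 m hm
      have k' := hm0 m' hm'
      have e₀ := congrFun h 0
      have e₁ := congrFun h 1
      simp only [Matrix.cons_val_zero, Matrix.cons_val_one] at e₀ e₁
      rw [div_eq_div_iff k k'] at e₀ e₁
      have c : (1 - m ^ 2) * (1 + m' ^ 2) = (1 - m' ^ 2) * (1 + m ^ 2) := by
        refine mul_left_cancel₀ ht ?_
        rw [← hp]
        linear_combination p 0 * e₀ + p 1 * e₁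
      have d : m * (1 + m' ^ 2) = m' * (1 + m ^ 2) := by
        refine mul_left_cancel₀ (mul_ne_zero h2 ht) ?_
        rw [← hp]
        linear_combination p 0 * e₁ - p 1 * e₀
      have c2 : m ^ 2 = m' ^ 2 := by
        refine mul_left_cancel₀ h2 ?_
        linear_combination -c
      refine mul_right_cancel₀ k ?_
      linear_combination d + m * c2
  rw [Set.ncard_eq_toFinset_card']
  have : Fintype.card F ≤ 3 * (circle t).toFinset.card := by omega
  exact_mod_cast this

theorem lpNorm_nonneg (p : ℝ≥0∞) (f : (Fin 2 → F) → ℝ) : 0 ≤ lpNorm p f := by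
  unfold lpNorm
  split_ifs
  · exact Real.iSup_nonneg fun _ => abs_nonneg _
  · exact Real.rpow_nonneg (mul_nonneg (by positivity)
      (Finset.sum_nonneg fun _ _ => Real.rpow_nonneg (abs_nonneg _) _)) _

/-- A function is dominated by its `L^p` norm times the `1/p`-th power of a function of
mean one. -/
theorem exists_le_lpNorm_mul_rpow {p : ℝ≥0∞} (hp : 1 ≤ p) {f : (Fin 2 → F) → ℝ}
    (hf : ∀ x, 0 ≤ f x) : ∃ g : (Fin 2 → F) → ℝ, (∀ x, 0 ≤ g x) ∧
      ∑ x, g x = (Fintype.card F : ℝ) ^ 2 ∧ ∀ x, f x ≤ lpNorm p f * g x ^ (p⁻¹).toReal := by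
  have hq : 0 < (Fintype.card F : ℝ) := by exact_mod_cast Fintype.card_pos
  by_cases hinf : p = ∞
  · refine ⟨fun _ => 1, fun _ => zero_le_one, by simp, fun x => ?_⟩
    simp only [hinf, lpNorm, if_true, Real.one_rpow, mul_one]
    exact (le_abs_self _).trans (le_ciSup (f := fun x => |f x|) (Set.finite_range _).bddAbove x)
  have hP : 0 < p.toReal := ENNReal.toReal_pos (zero_lt_one.trans_le hp).ne' hinf
  have hpow : ∀ x, 0 ≤ f x ^ p.toReal := fun x => Real.rpow_nonneg (hf x) _
  set S := ∑ x, f x ^ p.toReal with hS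
  have hS0 : 0 ≤ S := Finset.sum_nonneg fun x _ => hpow x
  rcases hS0.eq_or_lt with h0 | hpos
  · refine ⟨fun _ => 1, fun _ => zero_le_one, by simp, fun x => ?_⟩
    have := (Finset.sum_eq_zero_iff_of_nonneg fun x _ => hpow x).mp h0.symm x (Finset.mem_univ x)
    rw [(Real.rpow_eq_zero (hf x) hP.ne').mp this]
    exact mul_nonneg (lpNorm_nonneg p f) (by positivity)
  · refine ⟨fun x => f x ^ p.toReal * ((Fintype.card F : ℝ) ^ 2 / S),
      fun x => mul_nonneg (hpow x) (by positivity), ?_, fun x => le_of_eq ?_⟩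
    · rw [← Finset.sum_mul, ← hS]; field_simp
    · have e : lpNorm p f = (((Fintype.card F : ℝ) ^ 2)⁻¹ * S) ^ p.toReal⁻¹ := by
        simp only [lpNorm, hinf, if_false, one_div, hS, abs_of_nonneg (hf _)]
      rw [e, ENNReal.toReal_inv, ← Real.mul_rpow (by positivity)
        (mul_nonneg (hpow x) (by positivity))]
      have : ((Fintype.card F : ℝ) ^ 2)⁻¹ * S *
          (f x ^ p.toReal * ((Fintype.card F : ℝ) ^ 2 / S)) = f x ^ p.toReal := by
        field_simp
      rw [this, Real.rpow_rpow_inv (hf x) hP.ne']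

/-- In characteristic 2 the form ‖·‖ is additive, so a triangle with all sides t would give t = t +
t, hence t = 0. -/
theorem diamond_eq_zero_of_two_eq_zero {t : F} (ht : t ≠ 0) (h2 : (2 : F) = 0)
    (f₁ f₂ f₃ f₄ : (Fin 2 → F) → ℝ) : diamond t f₁ f₂ f₃ f₄ = 0 := by
  unfold diamond
  refine mul_eq_zero_of_right _ (Finset.sum_eq_zero fun x₁ _ => Finset.sum_eq_zero fun x₂ _ =>
    Finset.sum_eq_zero fun x₃ _ => Finset.sum_eq_zero fun x₄ _ => ?_)
  by_cases h₁ : quadNorm (x₁ - x₂) = t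
  swap; · simp [circleInd_of_ne h₁]
  by_cases h₂ : quadNorm (x₂ - x₃) = t
  swap; · simp [circleInd_of_ne h₂]
  have h₃ : quadNorm (x₁ - x₃) ≠ t := fun h₃ => ht <| by
    simp only [quadNorm_eq, Pi.sub_apply] at h₁ h₂ h₃
    linear_combination h₃ - h₁ - h₂ - ((x₁ 0 - x₂ 0) * (x₂ 0 - x₃ 0) +
      (x₁ 1 - x₂ 1) * (x₂ 1 - x₃ 1)) * h2
  simp [circleInd_of_ne h₃]

theorem diamond_le {t : F} (ht : t ≠ 0) {p₁ p₂ p₃ p₄ : ℝ≥0∞} (hp₁ : 1 ≤ p₁) (hp₂ : 1 ≤ p₂)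
    (hp₃ : 1 ≤ p₃) (hp₄ : 1 ≤ p₄)
    (c₁ : (p₁⁻¹).toReal + (p₂⁻¹).toReal + 2 * (p₃⁻¹).toReal + (p₄⁻¹).toReal ≤ 2)
    (c₂ : 2 * (p₁⁻¹).toReal + (p₂⁻¹).toReal + (p₃⁻¹).toReal + (p₄⁻¹).toReal ≤ 2)
    (c₃ : (p₁⁻¹).toReal + 2 * (p₂⁻¹).toReal + (p₃⁻¹).toReal + 2 * (p₄⁻¹).toReal ≤ 2)
    {f₁ f₂ f₃ f₄ : (Fin 2 → F) → ℝ} (h₁ : ∀ x, 0 ≤ f₁ x) (h₂ : ∀ x, 0 ≤ f₂ x)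
    (h₃ : ∀ x, 0 ≤ f₃ x) (h₄ : ∀ x, 0 ≤ f₄ x) :
    diamond t f₁ f₂ f₃ f₄ ≤
      12000 * (lpNorm p₁ f₁ * lpNorm p₂ f₂ * lpNorm p₃ f₃ * lpNorm p₄ f₄) := by
  have hq : 1 ≤ (Fintype.card F : ℝ) := by exact_mod_cast Fintype.card_pos
  have n₁ := lpNorm_nonneg p₁ f₁
  have n₂ := lpNorm_nonneg p₂ f₂
  have n₃ := lpNorm_nonneg p₃ f₃
  have n₄ := lpNorm_nonneg p₄ f₄
  by_cases h2 : (2 : F) = 0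
  · rw [diamond_eq_zero_of_two_eq_zero ht h2]; positivity
  rcases (circle t).eq_empty_or_nonempty with he | hne
  -- For an empty circle the normalizing factor is the inverse of 0, which is 0 by convention.
  · simp only [diamond, he, Set.ncard_empty, Nat.cast_zero, mul_zero, inv_zero, zero_mul]
    positivity
  have hN := card_le_ncard_circle ht h2 hne
  obtain ⟨g₁, k₁, s₁, l₁⟩ := exists_le_lpNorm_mul_rpow hp₁ h₁
  obtain ⟨g₂, k₂, s₂, l₂⟩ := exists_le_lpNorm_mul_rpow hp₂ h₂
  obtain ⟨g₃, k₃, s₃, l₃⟩ := exists_le_lpNorm_mul_rpow hp₃ h₃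
  obtain ⟨g₄, k₄, s₄, l₄⟩ := exists_le_lpNorm_mul_rpow hp₄ h₄
  have main := (isCodegreeKernel_circleInd ht h2).diamond_rpow_le k₁ k₂ k₃ k₄ hq le_rfl (by simp)
    s₁ s₂ s₃ s₄ ENNReal.toReal_nonneg ENNReal.toReal_nonneg ENNReal.toReal_nonneg
    ENNReal.toReal_nonneg c₁ c₂ c₃
  generalize (p₁⁻¹).toReal = a₁ at *
  generalize (p₂⁻¹).toReal = a₂ at *
  generalize (p₃⁻¹).toReal = a₃ at *
  generalize (p₄⁻¹).toReal = a₄ at *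
  generalize lpNorm p₁ f₁ = L₁ at *
  generalize lpNorm p₂ f₂ = L₂ at *
  generalize lpNorm p₃ f₃ = L₃ at *
  generalize lpNorm p₄ f₄ = L₄ at *
  have point : ∀ x₁ x₂ x₃ x₄, f₁ x₁ * f₂ x₂ * f₃ x₃ * f₄ x₄ ≤
      L₁ * L₂ * L₃ * L₄ * (g₁ x₁ ^ a₁ * g₂ x₂ ^ a₂ * g₃ x₃ ^ a₃ * g₄ x₄ ^ a₄) := by
    intro x₁ x₂ x₃ x₄
    have r₁ := Real.rpow_nonneg (k₁ x₁) a₁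
    have r₂ := Real.rpow_nonneg (k₂ x₂) a₂
    have r₃ := Real.rpow_nonneg (k₃ x₃) a₃
    calc f₁ x₁ * f₂ x₂ * f₃ x₃ * f₄ x₄ ≤ (L₁ * g₁ x₁ ^ a₁) * (L₂ * g₂ x₂ ^ a₂) *
          (L₃ * g₃ x₃ ^ a₃) * (L₄ * g₄ x₄ ^ a₄) :=
          mul_le_mul (mul_le_mul (mul_le_mul (l₁ x₁) (l₂ x₂) (h₂ _) (by positivity)) (l₃ x₃) (h₃ _)
            (by positivity)) (l₄ x₄) (h₄ _) (by positivity)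
      _ = _ := by ring
  have hs : ∑ x₁, ∑ x₂, ∑ x₃, ∑ x₄, circleInd t (x₁ - x₂) * circleInd t (x₂ - x₃) *
      circleInd t (x₃ - x₄) * circleInd t (x₄ - x₁) * circleInd t (x₁ - x₃) *
      (f₁ x₁ * f₂ x₂ * f₃ x₃ * f₄ x₄) ≤
      (L₁ * L₂ * L₃ * L₄) * (4000 * (Fintype.card F : ℝ) ^ 3) := by
    refine le_trans ?_ (mul_le_mul_of_nonneg_left main (by positivity))
    simp only [Finset.mul_sum]
    refine Finset.sum_le_sum fun x₁ _ => Finset.sum_le_sum fun x₂ _ => Finset.sum_le_sum fun x₃ _ =>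
      Finset.sum_le_sum fun x₄ _ => ?_
    have c := circleInd_nonneg t
    refine (mul_le_mul_of_nonneg_left (point x₁ x₂ x₃ x₄) (mul_nonneg (mul_nonneg (mul_nonneg
      (mul_nonneg (c _) (c _)) (c _)) (c _)) (c _))).trans_eq (by ring)
  have hN0 : 0 < ((circle t).ncard : ℝ) := by linarith
  unfold diamond
  rw [inv_mul_le_iff₀ (by positivity)]
  refine hs.trans ?_
  have hL : 0 ≤ L₁ * L₂ * L₃ * L₄ := by positivity
  -- One factor q is traded for 3|S_t|, whence 12000 = 3 · 4000.
  have := mul_le_mul_of_nonneg_left hN (by positivity :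
    0 ≤ 4000 * (L₁ * L₂ * L₃ * L₄) * (Fintype.card F : ℝ) ^ 2)
  nlinarith

end Geometry

/-- The conditions on the exponents in terms of the real numbers `1 / pᵢ`. -/
theorem necessaryConditions_iff {p₁ p₂ p₃ p₄ : ℝ≥0∞} (hp₁ : 1 ≤ p₁) (hp₂ : 1 ≤ p₂) (hp₃ : 1 ≤ p₃)
    (hp₄ : 1 ≤ p₄) : NecessaryConditions p₁ p₂ p₃ p₄ ↔
    (p₁⁻¹).toReal + (p₂⁻¹).toReal + 2 * (p₃⁻¹).toReal + (p₄⁻¹).toReal ≤ 2 ∧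
    2 * (p₁⁻¹).toReal + (p₂⁻¹).toReal + (p₃⁻¹).toReal + (p₄⁻¹).toReal ≤ 2 ∧
    (p₁⁻¹).toReal + 2 * (p₂⁻¹).toReal + (p₃⁻¹).toReal + 2 * (p₄⁻¹).toReal ≤ 2 := by
  have fin : ∀ {p : ℝ≥0∞}, 1 ≤ p → ∃ a : NNReal, p⁻¹ = a := fun {p} hp =>
    ⟨(p⁻¹).toNNReal, (ENNReal.coe_toNNReal (ENNReal.inv_ne_top.mpr
      (zero_lt_one.trans_le hp).ne')).symm⟩
  obtain ⟨a₁, e₁⟩ := fin hp₁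
  obtain ⟨a₂, e₂⟩ := fin hp₂
  obtain ⟨a₃, e₃⟩ := fin hp₃
  obtain ⟨a₄, e₄⟩ := fin hp₄
  simp only [NecessaryConditions, div_eq_mul_inv, one_mul, e₁, e₂, e₃, e₄, ENNReal.coe_toReal]
  norm_cast

theorem bounded_of_necessaryConditions {p₁ p₂ p₃ p₄ : ℝ≥0∞} (hp₁ : 1 ≤ p₁) (hp₂ : 1 ≤ p₂)
    (hp₃ : 1 ≤ p₃) (hp₄ : 1 ≤ p₄) (h : NecessaryConditions p₁ p₂ p₃ p₄) :
    Bounded p₁ p₂ p₃ p₄ := by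
  obtain ⟨c₁, c₂, c₃⟩ := (necessaryConditions_iff hp₁ hp₂ hp₃ hp₄).mp h
  exact ⟨12000, by norm_num, fun F _ _ _ t ht f₁ f₂ f₃ f₄ h₁ h₂ h₃ h₄ =>
    diamond_le ht hp₁ hp₂ hp₃ hp₄ c₁ c₂ c₃ h₁ h₂ h₃ h₄⟩

theorem Bounded.restrictedBounded {p₁ p₂ p₃ p₄ : ℝ≥0∞} (h : Bounded p₁ p₂ p₃ p₄) :
    RestrictedBounded p₁ p₂ p₃ p₄ := by
  obtain ⟨C, hC, h⟩ := h
  have nn : ∀ {F : Type} [Field F] (E : Set (Fin 2 → F)) (x : Fin 2 → F),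
      (0 : ℝ) ≤ E.indicator 1 x := fun E x => Set.indicator_nonneg (fun _ _ => zero_le_one) x
  exact ⟨C, hC, fun F _ _ h3 t ht E₁ E₂ E₃ E₄ =>
    h F h3 t ht _ _ _ _ (nn E₁) (nn E₂) (nn E₃) (nn E₄)⟩

/-! ### Necessity of the conditions: test functions in characteristic 3 -/

section Sharpness

variable {F : Type} [Field F] [Fintype F]

/-- Equality fails only for p = ∞ and empty `E`, where the right side is 0⁰ = 1. -/
theorem lpNorm_indicator_le {p : ℝ≥0∞} (hp : 1 ≤ p) (E : Set (Fin 2 → F)) :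
    lpNorm p (E.indicator 1) ≤
      (((Fintype.card F : ℝ) ^ 2)⁻¹ * E.ncard) ^ (p⁻¹).toReal := by
  classical
  by_cases hinf : p = ∞
  · simp only [hinf, lpNorm, if_true, ENNReal.inv_top, ENNReal.toReal_zero, Real.rpow_zero]
    refine ciSup_le fun x => ?_
    by_cases h : x ∈ E <;> simp [h]
  · have hP : 0 < p.toReal := ENNReal.toReal_pos (zero_lt_one.trans_le hp).ne' hinf
    have e : ∑ x, |E.indicator (1 : (Fin 2 → F) → ℝ) x| ^ p.toReal = E.ncard := by
      rw [Set.ncard_eq_toFinset_card', Finset.cast_card, ← Finset.sum_subset (Finset.subset_univ _)]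
      · exact Finset.sum_congr rfl fun x hx => by simp [Set.mem_toFinset.mp hx]
      · intro x _ hx
        have hx' : x ∉ E := fun h => hx (Set.mem_toFinset.mpr h)
        simp [hx', hP.ne']
    simp only [lpNorm, hinf, if_false, e, one_div, ENNReal.toReal_inv, le_refl]

theorem inv_toReal_le_one {p : ℝ≥0∞} (hp : 1 ≤ p) : (p⁻¹).toReal ≤ 1 :=
  ENNReal.toReal_le_of_le_ofReal zero_le_one (by simpa using hp)

theorem lpNorm_indicator_singleton_le {p : ℝ≥0∞} (hp : 1 ≤ p) :
    lpNorm p (({0} : Set (Fin 2 → F)).indicator 1) ≤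
      2 * (Fintype.card F : ℝ) ^ (-(2 * (p⁻¹).toReal)) := by
  have hq : 0 < (Fintype.card F : ℝ) := by exact_mod_cast Fintype.card_pos
  refine (lpNorm_indicator_le hp _).trans ?_
  rw [Set.ncard_singleton, Nat.cast_one, mul_one, ← Real.rpow_natCast, ← Real.rpow_neg hq.le,
    ← Real.rpow_mul hq.le]
  push_cast
  rw [neg_mul]
  linarith [Real.rpow_pos_of_pos hq (-(2 * (p⁻¹).toReal))]

theorem lpNorm_circleInd_le {p : ℝ≥0∞} (hp : 1 ≤ p) (t : F) :
    lpNorm p (circleInd t) ≤ 2 * (Fintype.card F : ℝ) ^ (-(p⁻¹).toReal) := by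
  have hq : 0 < (Fintype.card F : ℝ) := by exact_mod_cast Fintype.card_pos
  have ha : 0 ≤ (p⁻¹).toReal := ENNReal.toReal_nonneg
  refine (lpNorm_indicator_le hp _).trans ?_
  calc (((Fintype.card F : ℝ) ^ 2)⁻¹ * (circle t).ncard) ^ (p⁻¹).toReal
      ≤ (2 * (Fintype.card F : ℝ)⁻¹) ^ (p⁻¹).toReal := by
        refine Real.rpow_le_rpow (by positivity) ?_ ha
        rw [inv_mul_le_iff₀ (by positivity)]
        refine (ncard_circle_le t).trans_eq ?_
        field_simp
    _ = 2 ^ (p⁻¹).toReal * (Fintype.card F : ℝ) ^ (-(p⁻¹).toReal) := by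
        rw [Real.mul_rpow two_pos.le (by positivity), Real.inv_rpow hq.le, Real.rpow_neg hq.le]
    _ ≤ 2 * (Fintype.card F : ℝ) ^ (-(p⁻¹).toReal) := by
        refine mul_le_mul_of_nonneg_right ?_ (by positivity)
        simpa using Real.rpow_le_rpow_of_exponent_le one_le_two (inv_toReal_le_one hp)

/-- Lower bound for the form from the configurations `(e₁ x, e₂ x, e₃ x, e₄ x)`, `x ∈ S₁`. -/
theorem inv_sq_card_le_diamond {e₁ e₂ e₃ e₄ : F} (h₁₂ : (e₁ - e₂) ^ 2 = 1)
    (h₂₃ : (e₂ - e₃) ^ 2 = 1) (h₃₄ : (e₃ - e₄) ^ 2 = 1) (h₄₁ : (e₄ - e₁) ^ 2 = 1)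
    (h₁₃ : (e₁ - e₃) ^ 2 = 1) {f₁ f₂ f₃ f₄ : (Fin 2 → F) → ℝ} (n₁ : ∀ x, 0 ≤ f₁ x)
    (n₂ : ∀ x, 0 ≤ f₂ x) (n₃ : ∀ x, 0 ≤ f₃ x) (n₄ : ∀ x, 0 ≤ f₄ x)
    (k₁ : ∀ x, quadNorm x = 1 → f₁ (e₁ • x) = 1) (k₂ : ∀ x, quadNorm x = 1 → f₂ (e₂ • x) = 1)
    (k₃ : ∀ x, quadNorm x = 1 → f₃ (e₃ • x) = 1) (k₄ : ∀ x, quadNorm x = 1 → f₄ (e₄ • x) = 1) :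
    ((Fintype.card F : ℝ) ^ 2)⁻¹ ≤ diamond 1 f₁ f₂ f₃ f₄ := by
  classical
  have hq : 0 < (Fintype.card F : ℝ) := by exact_mod_cast Fintype.card_pos
  have hN : 0 < ((circle (1 : F)).ncard : ℝ) := by
    refine Nat.cast_pos.mpr ((Set.ncard_pos).mpr ⟨![1, 0], ?_⟩)
    change quadNorm _ = (1 : F)
    simp [quadNorm_eq]
  set T : (Fin 2 → F) × (Fin 2 → F) × (Fin 2 → F) × (Fin 2 → F) → ℝ := fun x =>
    circleInd 1 (x.1 - x.2.1) * circleInd 1 (x.2.1 - x.2.2.1) * circleInd 1 (x.2.2.1 - x.2.2.2) *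
      circleInd 1 (x.2.2.2 - x.1) * circleInd 1 (x.1 - x.2.2.1) *
      (f₁ x.1 * f₂ x.2.1 * f₃ x.2.2.1 * f₄ x.2.2.2) with hT
  have hT0 : ∀ x, 0 ≤ T x := fun x => by
    have c := circleInd_nonneg (1 : F)
    exact mul_nonneg (mul_nonneg (mul_nonneg (mul_nonneg (mul_nonneg (c _) (c _)) (c _)) (c _))
      (c _)) (mul_nonneg (mul_nonneg (mul_nonneg (n₁ _) (n₂ _)) (n₃ _)) (n₄ _))
  let φ : (Fin 2 → F) → (Fin 2 → F) × (Fin 2 → F) × (Fin 2 → F) × (Fin 2 → F) := fun x =>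
    (e₁ • x, e₂ • x, e₃ • x, e₄ • x)
  have hφ : Function.Injective φ := fun x y h => by
    simp only [φ, Prod.mk.injEq] at h
    have h0 : e₁ - e₂ ≠ 0 := fun h0 => by simp [h0] at h₁₂
    refine smul_right_injective _ h0 ?_
    simp only [sub_smul, h.1, h.2.1]
  have val : ∀ x, quadNorm x = 1 → T (φ x) = 1 := fun x hx => by
    have c : ∀ {a b : F}, (a - b) ^ 2 = 1 → circleInd 1 (a • x - b • x) = 1 := fun {a b} hab =>
      circleInd_of_eq (by rw [← sub_smul, quadNorm_smul, hab, hx, one_mul])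
    simp only [hT, φ, c h₁₂, c h₂₃, c h₃₄, c h₄₁, c h₁₃, k₁ x hx, k₂ x hx, k₃ x hx, k₄ x hx,
      one_mul]
  have sum : ((circle (1 : F)).ncard : ℝ) ≤ ∑ x, T x := by
    calc ((circle (1 : F)).ncard : ℝ) = ∑ x ∈ (circle (1 : F)).toFinset, T (φ x) := by
          rw [Finset.sum_congr rfl fun x hx => val x (Set.mem_toFinset (s := circle 1).mp hx),
            Set.ncard_eq_toFinset_card']
          simp
      _ = ∑ x ∈ (circle (1 : F)).toFinset.image φ, T x :=
          (Finset.sum_image hφ.injOn).symm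
      _ ≤ ∑ x, T x := Finset.sum_le_univ_sum_of_nonneg hT0
  simp only [Fintype.sum_prod_type, hT] at sum
  unfold diamond
  rw [mul_inv, mul_assoc]
  refine le_mul_of_one_le_right (by positivity) ?_
  rw [le_inv_mul_iff₀ hN, mul_one]
  exact sum

end Sharpness

/-- An estimate uniform over the fields with `3 ^ n` elements forces a condition on exponents. -/
theorem le_two_of_forall_card {C σ : ℝ}
    (h : ∀ n : ℕ, n ≠ 0 → (((3 : ℝ) ^ n) ^ 2)⁻¹ ≤ C * ((3 : ℝ) ^ n) ^ (-σ)) : σ ≤ 2 := by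
  by_contra! hσ
  have hlim : Filter.Tendsto (fun n : ℕ => ((3 : ℝ) ^ (σ - 2)) ^ n) Filter.atTop Filter.atTop :=
    tendsto_pow_atTop_atTop_of_one_lt (Real.one_lt_rpow (by norm_num) (by linarith))
  obtain ⟨n, hn, hn0⟩ := ((hlim.eventually_gt_atTop C).and (Filter.eventually_ne_atTop 0)).exists
  have hq : 0 < (3 : ℝ) ^ n := by positivity
  have e : ((3 : ℝ) ^ (σ - 2)) ^ n = ((3 : ℝ) ^ n) ^ σ * (((3 : ℝ) ^ n) ^ 2)⁻¹ := by
    rw [← Real.rpow_natCast, ← Real.rpow_mul (by norm_num), mul_comm, Real.rpow_mul (by norm_num),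
      Real.rpow_natCast, Real.rpow_sub hq, div_eq_mul_inv]
    norm_num
  have := mul_le_mul_of_nonneg_left (h n hn0) (Real.rpow_nonneg hq.le σ)
  rw [← e, Real.rpow_neg hq.le, mul_left_comm, mul_inv_cancel₀ (Real.rpow_pos_of_pos hq σ).ne',
    mul_one] at this
  linarith

/-- The fields with 3ⁿ elements are admissible since 3 = 0 is a square there. A form of size at
least q⁻² against norms decaying like q^{−σᵢ} then gives the inequality as n → ∞. -/
theorem le_two_of_bounded {p₁ p₂ p₃ p₄ : ℝ≥0∞} (h : Bounded p₁ p₂ p₃ p₄) {σ₁ σ₂ σ₃ σ₄ : ℝ}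
    (test : ∀ (F : Type) [Field F] [Fintype F] [CharP F 3], ∃ f₁ f₂ f₃ f₄ : (Fin 2 → F) → ℝ,
      (∀ x, 0 ≤ f₁ x) ∧ (∀ x, 0 ≤ f₂ x) ∧ (∀ x, 0 ≤ f₃ x) ∧ (∀ x, 0 ≤ f₄ x) ∧
      ((Fintype.card F : ℝ) ^ 2)⁻¹ ≤ diamond 1 f₁ f₂ f₃ f₄ ∧
      lpNorm p₁ f₁ ≤ 2 * (Fintype.card F : ℝ) ^ (-σ₁) ∧
      lpNorm p₂ f₂ ≤ 2 * (Fintype.card F : ℝ) ^ (-σ₂) ∧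
      lpNorm p₃ f₃ ≤ 2 * (Fintype.card F : ℝ) ^ (-σ₃) ∧
      lpNorm p₄ f₄ ≤ 2 * (Fintype.card F : ℝ) ^ (-σ₄)) :
    σ₁ + σ₂ + σ₃ + σ₄ ≤ 2 := by
  obtain ⟨C, hC, h⟩ := h
  refine le_two_of_forall_card (C := 16 * C) fun n hn => ?_
  have : Fact (Nat.Prime 3) := ⟨Nat.prime_three⟩
  have : Fintype (GaloisField 3 n) := Fintype.ofFinite _
  have hcard : (Fintype.card (GaloisField 3 n) : ℝ) = 3 ^ n := by
    rw [← Nat.card_eq_fintype_card, GaloisField.card 3 n hn]; norm_num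
  have h3 : IsSquare (3 : GaloisField 3 n) := by
    have : (3 : GaloisField 3 n) = 0 := by exact_mod_cast CharP.cast_eq_zero (GaloisField 3 n) 3
    rw [this]; exact IsSquare.zero
  obtain ⟨f₁, f₂, f₃, f₄, n₁, n₂, n₃, n₄, hd, l₁, l₂, l₃, l₄⟩ := test (GaloisField 3 n)
  have main := hd.trans (h _ h3 1 one_ne_zero f₁ f₂ f₃ f₄ n₁ n₂ n₃ n₄)
  rw [hcard] at *
  have hq : 0 < (3 : ℝ) ^ n := by positivity
  refine main.trans ?_
  calc C * (lpNorm p₁ f₁ * lpNorm p₂ f₂ * lpNorm p₃ f₃ * lpNorm p₄ f₄)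
      ≤ C * ((2 * ((3 : ℝ) ^ n) ^ (-σ₁)) * (2 * ((3 : ℝ) ^ n) ^ (-σ₂)) *
        (2 * ((3 : ℝ) ^ n) ^ (-σ₃)) * (2 * ((3 : ℝ) ^ n) ^ (-σ₄))) := by
        have m₁ := lpNorm_nonneg p₁ f₁
        have m₂ := lpNorm_nonneg p₂ f₂
        have m₃ := lpNorm_nonneg p₃ f₃
        have m₄ := lpNorm_nonneg p₄ f₄
        gcongr
    _ = 16 * C * ((3 : ℝ) ^ n) ^ (-(σ₁ + σ₂ + σ₃ + σ₄)) := by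
        rw [show -(σ₁ + σ₂ + σ₃ + σ₄) = -σ₁ + -σ₂ + -σ₃ + -σ₄ by ring, Real.rpow_add hq,
          Real.rpow_add hq, Real.rpow_add hq]
        ring

theorem Bounded.necessaryConditions {p₁ p₂ p₃ p₄ : ℝ≥0∞} (hp₁ : 1 ≤ p₁) (hp₂ : 1 ≤ p₂)
    (hp₃ : 1 ≤ p₃) (hp₄ : 1 ≤ p₄) (h : Bounded p₁ p₂ p₃ p₄) :
    NecessaryConditions p₁ p₂ p₃ p₄ := by
  have nn : ∀ {F : Type} [Field F] (x : Fin 2 → F),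
      (0 : ℝ) ≤ ({0} : Set (Fin 2 → F)).indicator 1 x :=
    fun x => Set.indicator_nonneg (fun _ _ => zero_le_one) x
  have origin : ∀ {F : Type} [Field F] (x : Fin 2 → F), quadNorm x = 1 →
      ({0} : Set (Fin 2 → F)).indicator (1 : (Fin 2 → F) → ℝ) ((0 : F) • x) = 1 := by simp
  have plus : ∀ {F : Type} [Field F] (x : Fin 2 → F), quadNorm x = 1 →
      circleInd 1 ((1 : F) • x) = 1 := fun x hx => circleInd_of_eq (by simpa using hx)
  have minus : ∀ {F : Type} [Field F] (x : Fin 2 → F), quadNorm x = 1 →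
      circleInd 1 ((-1 : F) • x) = 1 := fun x hx =>
    circleInd_of_eq (by rw [quadNorm_smul, hx]; ring)
  have three : ∀ {F : Type} [Field F] [CharP F 3], (3 : F) = 0 := fun {F} _ _ => by
    exact_mod_cast CharP.cast_eq_zero F 3
  rw [necessaryConditions_iff hp₁ hp₂ hp₃ hp₄]
  refine ⟨?_, ?_, ?_⟩
  -- The vertex placed at the origin contributes 2/p and those on the unit circle 1/p, so the origin
  -- goes where the condition has coefficient 2.
  · refine le_two_of_bounded h fun F _ _ _ => ⟨circleInd 1, circleInd 1, ({0} : Set _).indicator 1,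
      circleInd 1, circleInd_nonneg 1, circleInd_nonneg 1, nn, circleInd_nonneg 1,
      inv_sq_card_le_diamond (e₁ := 1) (e₂ := -1) (e₃ := 0) (e₄ := -1) ?_ ?_ ?_ ?_ ?_
        (circleInd_nonneg 1) (circleInd_nonneg 1) nn (circleInd_nonneg 1) plus minus origin minus,
      lpNorm_circleInd_le hp₁ 1, lpNorm_circleInd_le hp₂ 1, lpNorm_indicator_singleton_le hp₃,
      lpNorm_circleInd_le hp₄ 1⟩ <;> first | ring1 | linear_combination (three (F := F))
  · refine le_two_of_bounded h fun F _ _ _ => ⟨({0} : Set _).indicator 1, circleInd 1, circleInd 1,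
      circleInd 1, nn, circleInd_nonneg 1, circleInd_nonneg 1, circleInd_nonneg 1,
      inv_sq_card_le_diamond (e₁ := 0) (e₂ := -1) (e₃ := 1) (e₄ := -1) ?_ ?_ ?_ ?_ ?_
        nn (circleInd_nonneg 1) (circleInd_nonneg 1) (circleInd_nonneg 1) origin minus plus minus,
      lpNorm_indicator_singleton_le hp₁, lpNorm_circleInd_le hp₂ 1, lpNorm_circleInd_le hp₃ 1,
      lpNorm_circleInd_le hp₄ 1⟩ <;> first | ring1 | linear_combination (three (F := F))
  -- Vertices 2 and 4 are not joined, so both may sit at the origin.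
  · refine le_two_of_bounded h fun F _ _ _ => ⟨circleInd 1, ({0} : Set _).indicator 1, circleInd 1,
      ({0} : Set _).indicator 1, circleInd_nonneg 1, nn, circleInd_nonneg 1, nn,
      inv_sq_card_le_diamond (e₁ := 1) (e₂ := 0) (e₃ := -1) (e₄ := 0) ?_ ?_ ?_ ?_ ?_
        (circleInd_nonneg 1) nn (circleInd_nonneg 1) nn plus origin minus origin,
      lpNorm_circleInd_le hp₁ 1, lpNorm_indicator_singleton_le hp₂, lpNorm_circleInd_le hp₃ 1,
      lpNorm_indicator_singleton_le hp₄⟩ <;> first | ring1 | linear_combination (three (F := F))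

end DiamondForm

end

theorem theorem6p5 :
    (∀ p₁ p₂ p₃ p₄ : ℝ≥0∞, 1 ≤ p₁ → 1 ≤ p₂ → 1 ≤ p₃ → 1 ≤ p₄ →
      DiamondForm.Bounded p₁ p₂ p₃ p₄ → DiamondForm.NecessaryConditions p₁ p₂ p₃ p₄) ∧
    (∀ p₁ p₂ p₃ p₄ : ℝ≥0∞, 1 ≤ p₁ → 1 ≤ p₂ → 1 ≤ p₃ → 1 ≤ p₄ →
      DiamondForm.NecessaryConditions p₁ p₂ p₃ p₄ →
      (p₁, p₂, p₃, p₄) ≠ (2, 2, 2, ∞) → (p₁, p₂, p₃, p₄) ≠ (2, ∞, 2, 2) →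
      DiamondForm.Bounded p₁ p₂ p₃ p₄) ∧
    DiamondForm.RestrictedBounded 2 ∞ 2 2 ∧
    DiamondForm.RestrictedBounded 2 2 2 ∞ := by
  have e : ((2 : ℝ≥0∞)⁻¹).toReal = 1 / 2 := by simp
  refine ⟨fun p₁ p₂ p₃ p₄ h₁ h₂ h₃ h₄ h => h.necessaryConditions h₁ h₂ h₃ h₄,
    fun p₁ p₂ p₃ p₄ h₁ h₂ h₃ h₄ h _ _ =>
      DiamondForm.bounded_of_necessaryConditions h₁ h₂ h₃ h₄ h,
    -- The exceptional points satisfy (*) and the upper bound covers them, so the restricted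
    -- estimates are obtained from strong ones.
    (DiamondForm.bounded_of_necessaryConditions one_le_two le_top one_le_two one_le_two
      ?_).restrictedBounded,
    (DiamondForm.bounded_of_necessaryConditions one_le_two one_le_two one_le_two le_top
      ?_).restrictedBounded⟩
  · rw [DiamondForm.necessaryConditions_iff one_le_two le_top one_le_two one_le_two, e,
      ENNReal.inv_top, ENNReal.toReal_zero]
    norm_num
  · rw [DiamondForm.necessaryConditions_iff one_le_two one_le_two one_le_two le_top, e,
      ENNReal.inv_top, ENNReal.toReal_zero]
    norm_num
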